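/- All groups and graphs are finite, graphs are simple. For $d\ge 1$ let $\mathcal A(d)$ be the family of pairs $(\Gamma,G)$ with $\Gamma$ a connected graph of valency at most $d$ and $G\le\mathrm{Aut}(\Gamma)$ transitive on $V\Gamma$; a pair is determined up to isomorphism of graphs with group action. Let $(\Gamma,G)\in\mathcal A(d)$ with $G$ biquasiprimitive on $V\Gamma$ (some nontrivial normal subgroup of $G$ is intransitive, and every nontrivial normal subgroup has at most two orbits). Let $\Delta$ be an orbit of a nontrivial intransitive normal subgroup of $G$, let $G^+$ be the setwise stabiliser of $\Delta$ in $G$, and suppose that for $\alpha\in\Delta$ the stabiliser $G_\alpha$ is not transitive on $V\Gamma\setminus\Delta$. Then $G^+$ acts faithfully on $\Delta$; let $H$ denote $G^+$ in this action. Suppose that $G$ is of type (B)(i): there is a minimal normal subgroup $R$ of $H$, intransitive on $\Delta$, such that for $g\in G\setminus G^+$ the conjugate $S=R^g$ differs from $R$, the group $M=R\times S$ is transitive on $\Delta$, and $M$, as a subgroup of $G$, is a minimal normal subgroup of $G$ and equals the socle of $G$. Suppose further that $R$ and $S$ are nonabelian, $R=T_{R,1}\times\cdots\times T_{R,l}$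 and $S=T_{S,1}\times\cdots\times T_{S,l}$ with every factor identified with a nonabelian simple group $T$, and that for all $\alpha\in\Delta$ and all $j$ the coordinate projections $\pi_{R,j}:M\to T_{R,j}$ and $\pi_{S,j}:M\to T_{S,j}$ satisfy $\pi_{R,j}(M_\alpha)\ne T_{R,j}$ and $\pi_{S,j}(M_\alpha)\neq T_{S,j}$. Let $T_{\lambda_R}$ be the stabiliser in $T$ of a point $\lambda_R$ of the coset space $T/\pi_{R,j}(M_\alpha)$ and $T_{\lambda_S}$ that of a point $\lambda_S$ of $T/\pi_{S,j}(M_\alpha)$. Let $\Gamma^\Delta$ be the graph on $\Delta$ in which two distinct vertices are adjacent if their distance in $\Gamma$ is at most $2$. Let $\Lambda_R$ (respectively $\Lambda_S$) be the graph whose vertices are the orbits on $\Delta$ of $M_{R,j}=\ker\pi_{R,j}$ (respectively $M_{S,j}=\ker\pi_{S,j}$), two distinct orbits being adjacent if some edge of $\Gamma^\Delta$ joins them; $T\cong M/M_{R,j}$ acts on $\Lambda_R$ and $T\cong M/M_{S,j}$ acts on $\Lambda_S$. Then: 1. $l\le (d(d-1))^{d(d-1)}\min\{|T_{\lambda_R}|,|T_{\lambda_S}|\}^{2d(d-1)}$.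 2. $T$ acts faithfully and vertex-transitively by automorphisms on $\Lambda_R$ and on $\Lambda_S$, and these graphs have valency at most $d(d-1)$. If $\Gamma^\Delta$ is connected, which is the case whenever every edge of $\Gamma$ joins a vertex of $\Delta$ to a vertex outside $\Delta$, then $(\Lambda_R,T),(\Lambda_S,T)\in\mathcal A(d(d-1))$. 3. The vertex stabilisers of $T$ on $\Lambda_R$ are conjugate in $T$ to $T_{\lambda_R}$, and those on $\Lambda_S$ are conjugate in $T$ to $T_{\lambda_S}$. 4. $(\Gamma,G)$ determines the (unordered) pair $(\Lambda_R,T)$, $(\Lambda_S,T)$ uniquely up to isomorphism: it does not depend on the choice of $\Delta$, of $R$, of the decompositions of $R$ and $S$, or of $j$. -/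

import Mathlib

open scoped Pointwise

namespace BiQP

section Groups

variable {X : Type*} [Group X]

/-- A minimal normal subgroup. -/
def IsMinimalNormal (N : Subgroup X) : Prop :=
  N.Normal ∧ N ≠ ⊥ ∧ ∀ K : Subgroup X, K.Normal → K ≤ N → K = ⊥ ∨ K = N

variable (X) in
/-- The socle: the subgroup generated by all minimal normal subgroups. -/
def socle : Subgroup X := sSup {N : Subgroup X | IsMinimalNormal N}

end Groups

section Actions

variable (X W : Type*) [Group X] [MulAction X W]

/-- Every nontrivial normal subgroup is transitive. -/
def IsQuasiprimitive : Prop :=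
  ∀ N : Subgroup X, N.Normal → N ≠ ⊥ → MulAction.IsPretransitive N W

/-- Not quasiprimitive, but every nontrivial normal subgroup has at most two orbits. -/
def IsBiquasiprimitive : Prop :=
  ¬ IsQuasiprimitive X W ∧
    ∀ N : Subgroup X, N.Normal → N ≠ ⊥ → Nat.card (MulAction.orbitRel.Quotient N W) ≤ 2

end Actions

section Pairs

variable {W W' X X' : Type*} [Group X] [Group X']

/-- `X`, embedded in `Sym(W)` by `ρ`, is a vertex-transitive group of automorphisms of the
finite graph `Γ`, and `Γ` has valency at most `d`. -/
structure IsVertexTransitivePair (d : ℕ) (Γ : SimpleGraph W) (ρ : X →* Equiv.Perm W) :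
    Prop where
  finite : Finite W
  faithful : Function.Injective ρ
  adj_iff : ∀ x u v, Γ.Adj (ρ x u) (ρ x v) ↔ Γ.Adj u v
  transitive : ∀ u v, ∃ x, ρ x u = v
  valency_le : ∀ v, (Γ.neighborSet v).ncard ≤ d

/-- The family `𝒜(d)`: the pairs `(Γ, X)` with `Γ` a connected `X`-vertex-transitive graph of
valency at most `d`. -/
structure InFamilyA (d : ℕ) (Γ : SimpleGraph W) (ρ : X →* Equiv.Perm W) : Prop
    extends IsVertexTransitivePair d Γ ρ where
  connected : Γ.Connected

/-- Isomorphism of pairs (graph, group acting on the graph). -/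
def PairIso (Γ : SimpleGraph W) (ρ : X →* Equiv.Perm W)
    (Γ' : SimpleGraph W') (ρ' : X' →* Equiv.Perm W') : Prop :=
  ∃ (f : Γ ≃g Γ') (ψ : X ≃* X'), ∀ x w, f (ρ x w) = ρ' (ψ x) (f w)

end Pairs

section Quotients

variable {W X : Type*} [Group X] [MulAction X W]

/-- The normal quotient `Γ_K`: the vertices are the `K`-orbits, and distinct orbits are adjacent
if some edge of `Γ` joins them. -/
def normalQuotient (K : Subgroup X) (Γ : SimpleGraph W) :
    SimpleGraph (MulAction.orbitRel.Quotient K W) where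
  Adj a b := a ≠ b ∧ ∃ u v : W,
    (Quotient.mk'' u : MulAction.orbitRel.Quotient K W) = a ∧
    (Quotient.mk'' v : MulAction.orbitRel.Quotient K W) = b ∧ Γ.Adj u v
  symm := ⟨fun _ _ h => ⟨h.1.symm, by
    obtain ⟨u, v, hu, hv, huv⟩ := h.2
    exact ⟨v, u, hv, hu, huv.symm⟩⟩⟩
  loopless := ⟨fun _ h => h.1 rfl⟩

/-- The permutation `w^K ↦ (x w)^K` of the orbits of a normal subgroup `K`. -/
def orbitMap (K : Subgroup X) [K.Normal] (x : X) :
    MulAction.orbitRel.Quotient K W → MulAction.orbitRel.Quotient K W :=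
  Quotient.map' (fun w => x • w) (by
    rintro a b ⟨k, rfl⟩
    refine ⟨⟨x * k * x⁻¹, Subgroup.Normal.conj_mem ‹_› _ k.2 x⟩, ?_⟩
    simp [Subgroup.smul_def, mul_smul])

/-- The action of `X` on the set of orbits of a normal subgroup `K`. -/
def orbitAction (K : Subgroup X) [K.Normal] :
    X →* Equiv.Perm (MulAction.orbitRel.Quotient K W) where
  toFun x :=
    { toFun := orbitMap K x
      invFun := orbitMap K x⁻¹
      left_inv := by
        intro q
        induction q using Quotient.inductionOn' with
        | h w => simp [orbitMap]
      right_inv := by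
        intro q
        induction q using Quotient.inductionOn' with
        | h w => simp [orbitMap] }
  map_one' := by
    ext q
    induction q using Quotient.inductionOn' with
    | h w => simp [orbitMap]
  map_mul' x y := by
    ext q
    induction q using Quotient.inductionOn' with
    | h w => simp [orbitMap, mul_smul]

theorem orbitAction_of_mem (K : Subgroup X) [K.Normal] {x : X} (hx : x ∈ K) :
    orbitAction (W := W) K x = 1 := by
  ext q
  induction q using Quotient.inductionOn' with
  | h w => exact Quotient.sound' ⟨⟨x, hx⟩, rfl⟩

variable {T : Type*} [Group T]

/-- For an epimorphism `π : X → T`, the action of `T ≅ X / ker π` on the set of orbits of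
`ker π`. -/
noncomputable def quotientAction (π : X →* T) (hπ : Function.Surjective π) :
    T →* Equiv.Perm (MulAction.orbitRel.Quotient π.ker W) :=
  (QuotientGroup.lift π.ker (orbitAction (W := W) π.ker)
    (fun _ hx => orbitAction_of_mem π.ker hx)).comp
    (QuotientGroup.quotientKerEquivOfSurjective π hπ).symm.toMonoidHom

theorem quotientAction_apply (π : X →* T) (hπ : Function.Surjective π) (x : X) (w : W) :
    quotientAction (W := W) π hπ (π x) (Quotient.mk'' w) = Quotient.mk'' (x • w) := by
  have h : (QuotientGroup.quotientKerEquivOfSurjective π hπ).symm (π x) =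
      (x : X ⧸ π.ker) := by
    rw [MulEquiv.symm_apply_eq]
    rfl
  simp only [quotientAction, MonoidHom.comp_apply, MulEquiv.coe_toMonoidHom, h]
  rfl

end Quotients

section Biquasiprimitive

variable {V G : Type*} [Group G] [MulAction G V]

/-- The graph `Γ^Δ` on `Δ`: distinct vertices are adjacent if their distance in `Γ` is at most
two. -/
def distTwoGraph (Γ : SimpleGraph V) (Δ : Set V) : SimpleGraph Δ where
  Adj u v := u ≠ v ∧ Γ.edist (u : V) (v : V) ≤ 2
  symm := ⟨fun _ _ h => ⟨h.1.symm, by rw [SimpleGraph.edist_comm]; exact h.2⟩⟩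
  loopless := ⟨fun _ h => h.1 rfl⟩

variable (G) in
/-- `Δ` is an orbit of a nontrivial intransitive normal subgroup of `G`. -/
def IsHalf (Δ : Set V) : Prop :=
  ∃ N : Subgroup G, N.Normal ∧ N ≠ ⊥ ∧ ¬ MulAction.IsPretransitive N V ∧
    ∃ α : V, Δ = MulAction.orbit N α

variable (G) in
/-- `G⁺`, the setwise stabiliser of `Δ`. In the situation considered here it acts faithfully on
`Δ`, and `H` is `G⁺` regarded as a permutation group on `Δ`. -/
abbrev plus (Δ : Set V) : Subgroup G := MulAction.stabilizer G Δ

/-- Case (B)(i), for a subgroup `R` of `H = G⁺`. Conjugation by an element `g` of `G` outside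
`G⁺` induces the automorphism `φ` of `H`, so `S = R^φ` is the conjugate of `R` by `g`; and
`M = RS`, as a subgroup of `G`, is the diagonal subgroup `N = Diag_φ(M × M)`. -/
structure IsTypeBi (Δ : Set V) (R S : Subgroup (plus G Δ)) : Prop where
  minimal : IsMinimalNormal R
  intransitive : ¬ MulAction.IsPretransitive R Δ
  conj : ∀ g : G, g ∉ plus G Δ → S.map (plus G Δ).subtype =
    (R.map (plus G Δ).subtype).map (MulAut.conj g).toMonoidHom
  ne : S ≠ R
  transitive : MulAction.IsPretransitive (R ⊔ S : Subgroup (plus G Δ)) Δ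
  minimalN : IsMinimalNormal ((R ⊔ S).map (plus G Δ).subtype)
  socle_eq : socle G = (R ⊔ S).map (plus G Δ).subtype

variable (V G) in
/-- The data of case (B)(i) with `R`, `S` nonabelian, up to the choice of the decompositions
`R = T_{R,1} × ⋯ × T_{R,l}` and `S = T_{S,1} × ⋯ × T_{S,l}`. -/
structure Decomposition (T : Type*) [Group T] (l : ℕ) where
  /-- One of the two orbits of `G⁺`. -/
  Δ : Set V
  isHalf : IsHalf G Δ
  /-- The stabiliser of a point of `Δ` is intransitive on the other orbit of `G⁺`. -/
  stabilizer_intransitive : ∀ α ∈ Δ, ∃ β ∉ Δ, ∃ β' ∉ Δ,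
    ∀ g ∈ MulAction.stabilizer G α, g • β ≠ β'
  /-- The minimal normal subgroup `R` of `H`. -/
  R : Subgroup (plus G Δ)
  /-- The minimal normal subgroup `S = R^φ` of `H`. -/
  S : Subgroup (plus G Δ)
  typeBi : IsTypeBi Δ R S
  simple : IsSimpleGroup T
  nonabelian : ∃ a b : T, a * b ≠ b * a
  /-- `M = R × S = (T_{R,1} × ⋯ × T_{R,l}) × (T_{S,1} × ⋯ × T_{S,l})`. -/
  e : (R ⊔ S : Subgroup (plus G Δ)) ≃* (Fin l → T) × (Fin l → T)
  mem_R : ∀ m : (R ⊔ S : Subgroup (plus G Δ)), (m : plus G Δ) ∈ R ↔ (e m).2 = 1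
  mem_S : ∀ m : (R ⊔ S : Subgroup (plus G Δ)), (m : plus G Δ) ∈ S ↔ (e m).1 = 1

namespace Decomposition

variable {T : Type*} [Group T] {l : ℕ} (D : Decomposition V G T l)

/-- `M = R × S`. -/
abbrev M : Subgroup (plus G D.Δ) := D.R ⊔ D.S

/-- The projection `M → T_{R,j} = T`, with kernel `M_{R,j}`. -/
def projR (j : Fin l) : D.M →* T :=
  ((Pi.evalMonoidHom (fun _ => T) j).comp (MonoidHom.fst _ _)).comp D.e.toMonoidHom

/-- The projection `M → T_{S,j} = T`, with kernel `M_{S,j}`. -/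
def projS (j : Fin l) : D.M →* T :=
  ((Pi.evalMonoidHom (fun _ => T) j).comp (MonoidHom.snd _ _)).comp D.e.toMonoidHom

theorem projR_surjective (j : Fin l) : Function.Surjective (D.projR j) := fun t =>
  ⟨D.e.symm (fun _ => t, 1), by simp [projR]⟩

theorem projS_surjective (j : Fin l) : Function.Surjective (D.projS j) := fun t =>
  ⟨D.e.symm (1, fun _ => t), by simp [projS]⟩

/-- `U_{R,j} = π_{R,j}(M_α)`. -/
def UR (j : Fin l) (α : D.Δ) : Subgroup T := (MulAction.stabilizer D.M α).map (D.projR j)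

/-- `U_{S,j} = π_{S,j}(M_α)`. -/
def US (j : Fin l) (α : D.Δ) : Subgroup T := (MulAction.stabilizer D.M α).map (D.projS j)

/-- None of the projections `π_{R,j,α}`, `π_{S,j,α}` of `M_α` is surjective. -/
def NonSurjective : Prop := ∀ (j : Fin l) (α : D.Δ), D.UR j α ≠ ⊤ ∧ D.US j α ≠ ⊤

/-- The graph `Λ_R`: the normal quotient of `Γ^Δ` with respect to `M_{R,j}`. -/
def graphR (Γ : SimpleGraph V) (j : Fin l) :
    SimpleGraph (MulAction.orbitRel.Quotient (D.projR j).ker D.Δ) :=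
  normalQuotient (D.projR j).ker (distTwoGraph Γ D.Δ)

/-- The graph `Λ_S`: the normal quotient of `Γ^Δ` with respect to `M_{S,j}`. -/
def graphS (Γ : SimpleGraph V) (j : Fin l) :
    SimpleGraph (MulAction.orbitRel.Quotient (D.projS j).ker D.Δ) :=
  normalQuotient (D.projS j).ker (distTwoGraph Γ D.Δ)

/-- The action of `T = M / M_{R,j}` on the vertices of `Λ_R`. -/
noncomputable def actionR (j : Fin l) :
    T →* Equiv.Perm (MulAction.orbitRel.Quotient (D.projR j).ker D.Δ) :=
  quotientAction (D.projR j) (D.projR_surjective j)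

/-- The action of `T = M / M_{S,j}` on the vertices of `Λ_S`. -/
noncomputable def actionS (j : Fin l) :
    T →* Equiv.Perm (MulAction.orbitRel.Quotient (D.projS j).ker D.Δ) :=
  quotientAction (D.projS j) (D.projS_surjective j)

end Decomposition

/-- The stabilisers of the points of `W` under `ρ` are conjugate to the subgroup `U`. -/
def StabilizersConj {W T : Type*} [Group T] (ρ : T →* Equiv.Perm W) (U : Subgroup T) : Prop :=
  ∀ w : W, ∃ t : T, (MulAction.stabilizer (Equiv.Perm W) w).comap ρ =
    U.map (MulAut.conj t).toMonoidHom

end Biquasiprimitive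

end BiQP

/-! Everything is read off from the socle M = R × S, each of whose orbits on the vertices is one of
the two halves. For a coordinate projection π from M onto T, the kernel of π is normal in M, and T ≅
M / ker π acts on its orbits; the orbit of w has stabiliser π(M_w). Since this is a proper subgroup
and T is simple, the action is faithful. For the valency, let a vertex have a neighbours in its own
half and b ≥ 1 in the other. Vertices of Δ at distance two are reached through two edges inside Δ or
two edges across, so Γ^Δ has valency at most a + a(a-1) + b(b-1) ≤ (a+b)(a+b-1) ≤ d(d-1), and normal
quotients do not increase it.

The bound on l is a counting argument for R and S separately (`card_coordinates_le_of_connected`).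
Fix an edge from α to α' across the halves. Elements moving α or α' onto the remaining neighbours of
these two vertices generate a subgroup Q with M = Q M_α, by connectedness. By minimality, G⁺
permutes the l factors transitively, and symmetries fixing α still do so; pulling the generators of
Q back to one fixed coordinate gives each j a code. If r coordinates share a code, then on Q they
are determined by one of them, so |T|^r ≤ |T| u^r with u = |π(M_α)|, which forces r ≤ u
(`card_coordinates_le`). The codes are few because each pulled-back generator maps a known vertex to
one of few vertices, and its image under π then lies in a coset of a projected stabiliser.

For uniqueness, Δ is an orbit of the socle, so any two choices of Δ are translates under G. Among
the subgroups of the socle, R and S are the only minimal ones normalised by G⁺: another would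
centralise both, while M has trivial centre. An epimorphism from a power of T onto a nonabelian
simple group is a coordinate up to isomorphism, and G⁺ moves any coordinate of R, or of S, to any
other. -/

namespace BiQP

/-! ### Epimorphisms and automorphisms of powers of a nonabelian simple group -/

section PowersOfSimpleGroups

variable {ι T T' : Type*} [Group T] [Group T']

theorem center_eq_bot_of_isSimpleGroup [IsSimpleGroup T] (hna : ∃ a b : T, a * b ≠ b * a) :
    Subgroup.center T = ⊥ := by
  refine (Subgroup.Normal.eq_bot_or_eq_top inferInstance).resolve_right fun h => ?_
  obtain ⟨a, b, hab⟩ := hna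
  have ha : b ∈ Subgroup.center T := h ▸ Subgroup.mem_top b
  exact hab (Subgroup.mem_center_iff.1 ha a)

/-- An epimorphism from a power of a simple group onto a nonabelian simple group factors through
one of the coordinate projections. -/
theorem exists_eval_of_surjective [Finite ι] [IsSimpleGroup T] [IsSimpleGroup T']
    (hna : ∃ a b : T', a * b ≠ b * a) (φ : (ι → T) →* T') (hφ : Function.Surjective φ) :
    ∃ (i : ι) (τ : T ≃* T'), ∀ f, φ f = τ (f i) := by
  classical
  have hex : ∃ i : ι, ∃ t : T, φ (Pi.mulSingle i t) ≠ 1 := by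
    by_contra! h
    have h1 : φ = 1 := MonoidHom.pi_ext fun i x => h i x
    obtain ⟨a, b, hab⟩ := hna
    obtain ⟨f, rfl⟩ := hφ a
    exact hab (by simp [h1])
  obtain ⟨i, t₀, ht₀⟩ := hex
  let ψ : ι → T →* T' := fun k => φ.comp (MonoidHom.mulSingle (fun _ => T) k)
  have hψ : ∀ k t, ψ k t = φ (Pi.mulSingle k t) := fun k t => rfl
  -- Conjugation by `φ f` acts on the image of the `i`-th factor as conjugation by `f i`.
  have hnorm : (ψ i).range.Normal := by
    refine ⟨?_⟩
    rintro _ ⟨t, rfl⟩ g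
    obtain ⟨f, rfl⟩ := hφ g
    refine ⟨f i * t * (f i)⁻¹, ?_⟩
    rw [hψ, hψ, ← map_mul, ← map_inv, ← map_mul]
    congr 1
    ext k
    by_cases hk : k = i
    · subst hk; simp
    · simp [hk]
  have hrange : (ψ i).range = ⊤ := by
    refine hnorm.eq_bot_or_eq_top.resolve_left fun h => ht₀ ?_
    have : ψ i t₀ ∈ (ψ i).range := ⟨t₀, rfl⟩
    rwa [h, Subgroup.mem_bot] at this
  have hker : (ψ i).ker = ⊥ := by
    refine (Subgroup.Normal.eq_bot_or_eq_top inferInstance).resolve_right fun h => ht₀ ?_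
    have : t₀ ∈ (ψ i).ker := h ▸ Subgroup.mem_top t₀
    exact this
  -- The other factors commute with the `i`-th, whose image is all of `T'`; their images are
  -- therefore central, hence trivial.
  have hother : ∀ k, k ≠ i → ∀ t, φ (Pi.mulSingle k t) = 1 := by
    intro k hk t
    have hc : φ (Pi.mulSingle k t) ∈ Subgroup.center T' := by
      rw [Subgroup.mem_center_iff]
      intro g
      have hg : g ∈ (ψ i).range := hrange ▸ Subgroup.mem_top g
      obtain ⟨s, rfl⟩ := hg
      rw [hψ, ← map_mul, ← map_mul]
      exact congrArg φ (Pi.mulSingle_commute (f := fun _ : ι => T) hk.symm s t)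
    rwa [center_eq_bot_of_isSimpleGroup hna, Subgroup.mem_bot] at hc
  let τ : T ≃* T' := MulEquiv.ofBijective (ψ i)
    ⟨(MonoidHom.ker_eq_bot_iff _).1 hker, MonoidHom.range_eq_top.1 hrange⟩
  refine ⟨i, τ, fun f => ?_⟩
  have key : φ = (ψ i).comp (Pi.evalMonoidHom (fun _ => T) i) := by
    refine MonoidHom.pi_ext fun k x => ?_
    by_cases hk : k = i
    · subst hk; simp [hψ]
    · simp [hψ, hother k hk, Ne.symm hk]
  exact DFunLike.congr_fun key f

variable {X : Type*} [Group X] [Finite ι] [IsSimpleGroup T] [IsSimpleGroup T']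

/-- Since `s` is a section of `p`, the element `m * (s (p m))⁻¹` lies in `p.ker`, so `φ` factors
through `p` and the case of a power of `T` applies. -/
theorem exists_eval_of_ker_le (hna : ∃ a b : T', a * b ≠ b * a) (p : X →* (ι → T))
    (s : (ι → T) →* X) (hps : ∀ f, p (s f) = f) (φ : X →* T') (hφ : Function.Surjective φ)
    (hker : p.ker ≤ φ.ker) : ∃ (i : ι) (τ : T ≃* T'), ∀ m, φ m = τ (p m i) := by
  have hφs : ∀ m, φ m = φ (s (p m)) := by
    intro m
    have : φ (m * (s (p m))⁻¹) = 1 := hker (by simp [MonoidHom.mem_ker, hps])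
    rwa [map_mul, map_inv, mul_inv_eq_one] at this
  obtain ⟨i, τ, h⟩ := exists_eval_of_surjective hna (φ.comp s) (fun t => by
    obtain ⟨m, rfl⟩ := hφ t
    exact ⟨p m, (hφs m).symm⟩)
  exact ⟨i, τ, fun m => (hφs m).trans (h (p m))⟩

/-- If `s` embeds a power of a nonabelian simple group as a subgroup that is minimal among the
subgroups invariant under a group `A` of automorphisms, then `A` permutes the simple factors
transitively. -/
theorem exists_aut_coordinate (hna : ∃ a b : T, a * b ≠ b * a) (p : X →* (ι → T))
    (s : (ι → T) →* X) (hps : ∀ f, p (s f) = f) (A : Subgroup (MulAut X))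
    (hker : ∀ c ∈ A, ∀ m ∈ p.ker, c m ∈ p.ker)
    (hs : ∀ c ∈ A, ∀ m ∈ s.range, c m ∈ s.range)
    (hmin : ∀ K : Subgroup X, K ≤ s.range → (∀ c ∈ A, ∀ m ∈ K, c m ∈ K) →
      K = ⊥ ∨ K = s.range) (i j : ι) :
    ∃ c ∈ A, ∃ τ : T ≃* T, ∀ m, p (c m) j = τ (p m i) := by
  classical
  by_contra! hcon
  obtain ⟨t, ht⟩ := exists_ne (1 : T)
  have hcoord : ∀ c ∈ A, ∃ k, k ≠ i ∧ ∃ τ : T ≃* T, ∀ m, p (c m) j = τ (p m k) := by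
    intro c hc
    let φ : X →* T := ((Pi.evalMonoidHom (fun _ => T) j).comp p).comp c.toMonoidHom
    have hφ : ∀ m, φ m = p (c m) j := fun m => rfl
    obtain ⟨k, τ, h⟩ := exists_eval_of_ker_le hna p s hps φ
      (fun t => ⟨c⁻¹ (s fun _ => t), by
        rw [hφ, MulAut.apply_inv_self, hps]⟩)
      (fun m hm => by
        have : p (c m) = 1 := hker c hc m hm
        rw [MonoidHom.mem_ker, hφ, this, Pi.one_apply])
    refine ⟨k, ?_, τ, h⟩
    rintro rfl
    obtain ⟨m, hm⟩ := hcon c hc τ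
    exact hm (h m)
  -- If no element of `A` carries coordinate `i` to coordinate `j`, this `A`-invariant subgroup
  -- contains the whole `i`-th factor, yet omits the constant tuples with value `t ≠ 1`. This
  -- contradicts minimality.
  let K : Subgroup X :=
    { carrier := {m | m ∈ s.range ∧ ∀ c ∈ A, p (c m) j = 1}
      one_mem' := ⟨one_mem _, fun c _ => by simp⟩
      mul_mem' := fun {a b} ha hb => ⟨mul_mem ha.1 hb.1, fun c hc => by
        simp [ha.2 c hc, hb.2 c hc]⟩
      inv_mem' := fun {a} ha => ⟨inv_mem ha.1, fun c hc => by simp [ha.2 c hc]⟩ }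
  rcases hmin K (fun m hm => hm.1)
    (fun c hc m hm => ⟨hs c hc m hm.1, fun c' hc' => by
      simpa using hm.2 (c' * c) (mul_mem hc' hc)⟩) with hK | hK
  · have hmem : s (Pi.mulSingle i t) ∈ K := by
      refine ⟨⟨_, rfl⟩, fun c hc => ?_⟩
      obtain ⟨k, hk, τ, h⟩ := hcoord c hc
      rw [h, hps, Pi.mulSingle_eq_of_ne hk, map_one]
    rw [hK, Subgroup.mem_bot] at hmem
    have h1 := congrFun (hps (Pi.mulSingle i t)) i
    rw [hmem, map_one, Pi.one_apply, Pi.mulSingle_eq_same] at h1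
    exact ht h1.symm
  · have hmem : s (fun _ => t) ∈ K := hK ▸ ⟨_, rfl⟩
    have h1 := hmem.2 1 (one_mem A)
    rw [MulAut.one_apply, hps] at h1
    exact ht h1

end PowersOfSimpleGroups

/-! ### Quotients of a graph by the kernel of an epimorphism -/

section QuotientGraphs

variable {W X T : Type*} [Group X] [MulAction X W] [Group T]

/-- If `x • w = k • w` with `k` in the kernel, then `k⁻¹ * x` fixes `w` and has the same image as
`x`. -/
theorem quotientAction_fixes_iff (π : X →* T) (hπ : Function.Surjective π) (w : W) (t : T) :
    quotientAction (W := W) π hπ t (Quotient.mk'' w) = Quotient.mk'' w ↔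
      t ∈ (MulAction.stabilizer X w).map π := by
  obtain ⟨x, rfl⟩ := hπ t
  rw [quotientAction_apply]
  constructor
  · intro h
    obtain ⟨k, hk⟩ := Quotient.exact' h
    have hk' : (k : X) • w = x • w := hk
    refine ⟨(k : X)⁻¹ * x, ?_, ?_⟩
    · simp [mul_smul, ← hk']
    · have : π (k : X) = 1 := k.2
      simp [this]
  · rintro ⟨y, hy, hxy⟩
    refine Quotient.sound' ⟨⟨x * y⁻¹, by simp [MonoidHom.mem_ker, hxy]⟩, ?_⟩
    have hy' : y⁻¹ • w = w := inv_smul_eq_iff.2 (MulAction.mem_stabilizer_iff.1 hy).symm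
    change (x * y⁻¹) • w = x • w
    rw [mul_smul, hy']

theorem comap_stabilizer_quotientAction (π : X →* T) (hπ : Function.Surjective π) (w : W) :
    (MulAction.stabilizer (Equiv.Perm (MulAction.orbitRel.Quotient π.ker W))
      (Quotient.mk'' w : MulAction.orbitRel.Quotient π.ker W)).comap (quotientAction π hπ) =
      (MulAction.stabilizer X w).map π := by
  ext t
  rw [Subgroup.mem_comap, MulAction.mem_stabilizer_iff, Equiv.Perm.smul_def,
    quotientAction_fixes_iff]

theorem map_stabilizer_smul (π : X →* T) (x : X) (w : W) :
    (MulAction.stabilizer X (x • w)).map π =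
      ((MulAction.stabilizer X w).map π).map (MulAut.conj (π x)).toMonoidHom := by
  rw [MulAction.stabilizer_smul_eq_stabilizer_map_conj, Subgroup.map_map, Subgroup.map_map]
  congr 1
  ext y
  simp

theorem map_conj_map_conj (U : Subgroup T) (s t : T) :
    (U.map (MulAut.conj t).toMonoidHom).map (MulAut.conj s).toMonoidHom =
      U.map (MulAut.conj (s * t)).toMonoidHom := by
  rw [Subgroup.map_map]
  congr 1
  ext y
  simp [mul_assoc]

theorem map_conj_one (U : Subgroup T) : U.map (MulAut.conj (1 : T)).toMonoidHom = U := by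
  ext y; simp

theorem stabilizer_coset (U : Subgroup T) (t : T) :
    MulAction.stabilizer T (t : T ⧸ U) = U.map (MulAut.conj t).toMonoidHom := by
  have : (t : T ⧸ U) = t • ((1 : T) : T ⧸ U) := by simp
  rw [this, MulAction.stabilizer_smul_eq_stabilizer_map_conj, MulAction.stabilizer_quotient]

theorem natCard_stabilizer_coset (U : Subgroup T) (q : T ⧸ U) :
    Nat.card (MulAction.stabilizer T q) = Nat.card U := by
  induction q using QuotientGroup.induction_on with
  | H t =>
    rw [stabilizer_coset]
    exact (Nat.card_congr (U.equivMapOfInjective _ (MulAut.conj t).injective).toEquiv).symm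

theorem stabilizersConj_quotientAction [MulAction.IsPretransitive X W] (π : X →* T)
    (hπ : Function.Surjective π) (w : W) (q : T ⧸ (MulAction.stabilizer X w).map π) :
    StabilizersConj (quotientAction (W := W) π hπ) (MulAction.stabilizer T q) := by
  intro a
  induction a using Quotient.inductionOn' with
  | h v =>
    induction q using QuotientGroup.induction_on with
    | H t =>
      obtain ⟨x, rfl⟩ := MulAction.exists_smul_eq X w v
      refine ⟨π x * t⁻¹, ?_⟩
      rw [comap_stabilizer_quotientAction, map_stabilizer_smul, stabilizer_coset,
        map_conj_map_conj, inv_mul_cancel_right]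

/-- An edge between two orbits can be translated by `K` so that it starts at `w`; hence every
neighbouring orbit contains a neighbour of `w`. -/
theorem ncard_neighborSet_normalQuotient_le [Finite W] (K : Subgroup X) (Θ : SimpleGraph W)
    (hadj : ∀ (x : X) u v, Θ.Adj (x • u) (x • v) ↔ Θ.Adj u v) (w : W) :
    ((normalQuotient K Θ).neighborSet (Quotient.mk'' w)).ncard ≤ (Θ.neighborSet w).ncard := by
  refine (Set.ncard_le_ncard (t := (Quotient.mk'' : W → MulAction.orbitRel.Quotient K W) ''
    Θ.neighborSet w) ?_ (Set.toFinite _)).trans (Set.ncard_image_le (Set.toFinite _))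
  rintro b ⟨-, u, v, hu, rfl, huv⟩
  obtain ⟨k, hk⟩ := Quotient.exact' hu
  have hk' : (k : X) • w = u := hk
  refine ⟨(k : X)⁻¹ • v, ?_, Quotient.sound' ⟨k⁻¹, rfl⟩⟩
  rw [SimpleGraph.mem_neighborSet, ← hadj (k : X), smul_inv_smul, hk']
  exact huv

theorem normalQuotient_connected (K : Subgroup X) {Θ : SimpleGraph W} (h : Θ.Connected) :
    (normalQuotient K Θ).Connected := by
  have hreach : ∀ u v : W, Θ.Reachable u v →
      (normalQuotient K Θ).Reachable (Quotient.mk'' u) (Quotient.mk'' v) := by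
    rintro u v ⟨p⟩
    induction p with
    | nil => exact SimpleGraph.Reachable.refl _
    | @cons u v w huv p ih =>
      refine SimpleGraph.Reachable.trans ?_ ih
      by_cases he : (Quotient.mk'' u : MulAction.orbitRel.Quotient K W) = Quotient.mk'' v
      · rw [he]
      · exact SimpleGraph.Adj.reachable ⟨he, u, v, rfl, rfl, huv⟩
  obtain ⟨w⟩ := h.nonempty
  have : Nonempty (MulAction.orbitRel.Quotient K W) := ⟨Quotient.mk'' w⟩
  refine ⟨fun a b => ?_⟩
  induction a using Quotient.inductionOn' with
  | h u =>
    induction b using Quotient.inductionOn' with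
    | h v => exact hreach u v (h.preconnected u v)

theorem normalQuotient_adj_of_adj (π : X →* T) (hπ : Function.Surjective π) (Θ : SimpleGraph W)
    (hadj : ∀ (x : X) u v, Θ.Adj (x • u) (x • v) ↔ Θ.Adj u v) (t : T)
    (a b : MulAction.orbitRel.Quotient π.ker W) (h : (normalQuotient π.ker Θ).Adj a b) :
    (normalQuotient π.ker Θ).Adj (quotientAction π hπ t a) (quotientAction π hπ t b) := by
  obtain ⟨x, rfl⟩ := hπ t
  obtain ⟨hab, u, v, rfl, rfl, huv⟩ := h
  refine ⟨fun he => hab ((quotientAction π hπ (π x)).injective he), x • u, x • v, ?_, ?_,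
    (hadj x u v).2 huv⟩ <;> rw [quotientAction_apply]

/-- Faithfulness is where simplicity enters: a nontrivial kernel would be all of `T`, and then the
projected stabiliser of `w` would be `⊤`. -/
theorem isVertexTransitivePair_quotient [Finite W] [MulAction.IsPretransitive X W]
    [IsSimpleGroup T] (k : ℕ) (Θ : SimpleGraph W)
    (hadj : ∀ (x : X) u v, Θ.Adj (x • u) (x • v) ↔ Θ.Adj u v)
    (hval : ∀ w, (Θ.neighborSet w).ncard ≤ k) (π : X →* T) (hπ : Function.Surjective π) (w : W)
    (hw : (MulAction.stabilizer X w).map π ≠ ⊤) :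
    IsVertexTransitivePair k (normalQuotient π.ker Θ) (quotientAction (W := W) π hπ) where
  finite := Quotient.finite _
  faithful := by
    rw [← MonoidHom.ker_eq_bot_iff]
    refine (Subgroup.Normal.eq_bot_or_eq_top inferInstance).resolve_right fun h => hw ?_
    rw [eq_top_iff]
    intro t _
    have ht : t ∈ (quotientAction (W := W) π hπ).ker := h ▸ Subgroup.mem_top t
    rw [← quotientAction_fixes_iff π hπ, MonoidHom.mem_ker.1 ht, Equiv.Perm.one_apply]
  adj_iff t a b := by
    refine ⟨fun h => ?_, normalQuotient_adj_of_adj π hπ Θ hadj t a b⟩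
    simpa using normalQuotient_adj_of_adj π hπ Θ hadj t⁻¹ _ _ h
  transitive a b := by
    induction a using Quotient.inductionOn' with
    | h u =>
      induction b using Quotient.inductionOn' with
      | h v =>
        obtain ⟨x, rfl⟩ := MulAction.exists_smul_eq X u v
        exact ⟨π x, quotientAction_apply π hπ x u⟩
  valency_le a := by
    induction a using Quotient.inductionOn' with
    | h u => exact (ncard_neighborSet_normalQuotient_le π.ker Θ hadj u).trans (hval u)

/-- Compatible isomorphisms of the groups, of the graphs and of the epimorphic images induce an
isomorphism of the quotient pairs. -/
theorem pairIso_quotient {W' X' T' : Type*} [Group X'] [MulAction X' W'] [Group T']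
    {Θ₁ : SimpleGraph W} {Θ₂ : SimpleGraph W'} (π : X →* T) (hπ : Function.Surjective π)
    (π' : X' →* T') (hπ' : Function.Surjective π') (c : X ≃* X') (f : Θ₁ ≃g Θ₂)
    (hf : ∀ x w, f (x • w) = c x • f w) (τ : T ≃* T') (hτ : ∀ x, π' (c x) = τ (π x)) :
    PairIso (normalQuotient π.ker Θ₁) (quotientAction π hπ)
      (normalQuotient π'.ker Θ₂) (quotientAction π' hπ') := by
  have hrel : ∀ u v : W, MulAction.orbitRel π.ker W u v ↔
      MulAction.orbitRel π'.ker W' (f.toEquiv u) (f.toEquiv v) := by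
    intro u v
    constructor
    · rintro ⟨k, rfl⟩
      refine ⟨⟨c k, ?_⟩, (hf k v).symm⟩
      have hk : π (k : X) = 1 := k.2
      rw [MonoidHom.mem_ker, hτ, hk, map_one]
    · rintro ⟨k, hk⟩
      have hk1 : π' (k : X') = 1 := k.2
      refine ⟨⟨c.symm k, ?_⟩, ?_⟩
      · rw [MonoidHom.mem_ker, ← τ.injective.eq_iff, ← hτ, MulEquiv.apply_symm_apply, hk1, map_one]
      · refine f.injective ?_
        change f (c.symm k • v) = f u
        rw [hf, MulEquiv.apply_symm_apply]
        exact hk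
  let F : MulAction.orbitRel.Quotient π.ker W ≃ MulAction.orbitRel.Quotient π'.ker W' :=
    Quotient.congr f.toEquiv hrel
  have hF : ∀ w, F (Quotient.mk'' w) = Quotient.mk'' (f w) := fun w => rfl
  refine ⟨⟨F, ?_⟩, τ, ?_⟩
  · intro a b
    constructor
    · rintro ⟨hab, u, v, hu, hv, huv⟩
      refine ⟨fun h => hab (congrArg F h), f.symm u, f.symm v, ?_, ?_, ?_⟩
      · apply F.injective; rw [hF, f.apply_symm_apply, hu]
      · apply F.injective; rw [hF, f.apply_symm_apply, hv]
      · exact f.symm.map_rel_iff.2 huv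
    · rintro ⟨hab, u, v, rfl, rfl, huv⟩
      exact ⟨fun h => hab (F.injective h), f u, f v, rfl, rfl, f.map_rel_iff.2 huv⟩
  · intro t a
    obtain ⟨x, rfl⟩ := hπ t
    induction a using Quotient.inductionOn' with
    | h w =>
      change F (quotientAction π hπ (π x) (Quotient.mk'' w)) =
        quotientAction π' hπ' (τ (π x)) (F (Quotient.mk'' w))
      rw [quotientAction_apply, hF, hF, ← hτ, quotientAction_apply, hf]

end QuotientGraphs

/-! ### Bounding the number of simple factors -/

section CoordinateBound

variable {X V T : Type*} [Group X] [MulAction X V] [Group T]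

/-- Induction along a walk: once `q` reaches the current vertex, `q⁻¹` brings the next one next to
`α` or `α'`, where `hQ` applies. -/
theorem exists_mem_smul_eq_of_connected {Γ : SimpleGraph V} (hconn : Γ.Connected)
    (hadj : ∀ (x : X) u v, Γ.Adj (x • u) (x • v) ↔ Γ.Adj u v) {α α' : V} (Q : Subgroup X)
    (hQ : ∀ β, Γ.Adj α β ∨ Γ.Adj α' β → ∃ q ∈ Q, q • α = β ∨ q • α' = β) (v : V) :
    ∃ q ∈ Q, q • α = v ∨ q • α' = v := by
  have hwalk : ∀ u w : V, Γ.Reachable u w → (∃ q ∈ Q, q • α = u ∨ q • α' = u) →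
      ∃ q ∈ Q, q • α = w ∨ q • α' = w := by
    rintro u w ⟨p⟩
    induction p with
    | nil => exact id
    | @cons u v w huv p ih =>
      rintro ⟨q, hq, hqu⟩
      refine ih ?_
      obtain ⟨q', hq', hqv⟩ := hQ (q⁻¹ • v) (by
        rcases hqu with h | h
        · left; rwa [← hadj q, smul_inv_smul, h]
        · right; rwa [← hadj q, smul_inv_smul, h])
      refine ⟨q * q', mul_mem hq hq', ?_⟩
      rcases hqv with h | h
      · left; rw [mul_smul, h, smul_inv_smul]
      · right; rw [mul_smul, h, smul_inv_smul]
  exact hwalk α v (hconn.preconnected α v) ⟨1, one_mem Q, Or.inl (one_smul X α)⟩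

/-- Cancelling leaves `n ^ (r - 1) ≤ u` for `r ≥ 1`, and `r ≤ 2 ^ (r - 1)`. -/
theorem le_of_mul_pow_le {n u r : ℕ} (hn : 2 ≤ n) (hu : 0 < u)
    (h : (n * u) ^ r ≤ n * u * u ^ r) : r ≤ u := by
  rcases r with _ | k
  · exact Nat.zero_le _
  · rw [mul_pow] at h
    have h1 : n ^ (k + 1) ≤ n * u := Nat.le_of_mul_le_mul_right h (by positivity)
    rw [pow_succ'] at h1
    have h2 : n ^ k ≤ u := Nat.le_of_mul_le_mul_left h1 (by omega)
    exact (Nat.lt_two_pow_self.trans_le (Nat.pow_le_pow_left hn k)).trans_le h2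

/-- If `X = QY`, and the coordinates in `J` of the elements of `Q` are determined by a single one
of them, then `J` is small. -/
theorem card_coordinates_le [Finite T] {ι : Type*} (p : X →* (ι → T))
    (hp : Function.Surjective p) (Q Y : Subgroup X) (hQY : ∀ m, ∃ q ∈ Q, q⁻¹ * m ∈ Y) (u : ℕ)
    (J : Finset ι)
    (hu : ∀ j ∈ J, Nat.card (Y.map ((Pi.evalMonoidHom (fun _ => T) j).comp p)) = u)
    (htop : ∀ j ∈ J, Y.map ((Pi.evalMonoidHom (fun _ => T) j).comp p) ≠ ⊤) (ψ : X → T)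
    (ε : ι → T → T) (hψ : ∀ j ∈ J, ∀ q ∈ Q, p q j = ε j (ψ q)) : J.card ≤ u := by
  classical
  rcases J.eq_empty_or_nonempty with rfl | ⟨j₀, hj₀⟩
  · simp
  let U : ι → Subgroup T := fun j => Y.map ((Pi.evalMonoidHom (fun _ => T) j).comp p)
  have hupos : 0 < u := hu j₀ hj₀ ▸ Nat.card_pos
  -- Writing `m = q * y` with `q ∈ Q` and `y ∈ Y`, the `J`-coordinates of `q` depend only on `ψ q`
  -- and those of `y` lie in the `U j`; so `F` is onto, and |T|^r ≤ |T| u^r where r = |J|.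
  let F : T × (∀ j : J, U j) → (J → T) := fun z j => ε j z.1 * z.2 j
  have hF : Function.Surjective F := by
    intro y
    obtain ⟨m, hm⟩ := hp (fun j => if h : j ∈ J then y ⟨j, h⟩ else 1)
    obtain ⟨q, hq, hqm⟩ := hQY m
    refine ⟨(ψ q, fun j => ⟨p (q⁻¹ * m) j, ⟨_, hqm, rfl⟩⟩), ?_⟩
    ext j
    have hj : p m j = y j := by rw [hm]; simp
    change ε j (ψ q) * p (q⁻¹ * m) j = y j
    rw [← hψ j j.2 q hq, ← hj]
    simp
  have hcard := Nat.card_le_card_of_surjective F hF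
  rw [Nat.card_prod, Nat.card_pi, Nat.card_pi, Finset.prod_const, Finset.card_univ,
    Fintype.card_coe] at hcard
  have hprod : ∏ j : J, Nat.card (U j) = u ^ J.card := by
    rw [Finset.prod_congr rfl (fun (j : J) _ => hu (j : ι) j.2), Finset.prod_const, Finset.card_univ,
      Fintype.card_coe]
  rw [hprod, ← (U j₀).index_mul_card, show Nat.card (U j₀) = u from hu j₀ hj₀] at hcard
  refine le_of_mul_pow_le ?_ hupos hcard
  have h0 : (U j₀).index ≠ 0 := Subgroup.index_ne_zero_of_finite
  have h1 : (U j₀).index ≠ 1 := fun h => htop j₀ hj₀ (Subgroup.index_eq_one.1 h)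
  omega

/-- The elements taking `s` to `δ` are either absent or form a coset of the stabiliser of `s`. -/
theorem ncard_image_transporter_le [Finite T] (π : X →* T) (s δ : V) :
    (π '' {x : X | x • s = δ}).ncard ≤ Nat.card ((MulAction.stabilizer X s).map π) := by
  rcases Set.eq_empty_or_nonempty {x : X | x • s = δ} with h | ⟨x₀, hx₀⟩
  · simp [h]
  · have hsub : π '' {x : X | x • s = δ} ⊆
        (fun t => π x₀ * t) '' ((MulAction.stabilizer X s).map π : Set T) := by
      rintro _ ⟨x, hx, rfl⟩
      refine ⟨π (x₀⁻¹ * x), ⟨x₀⁻¹ * x, ?_, rfl⟩, by simp⟩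
      have hx' : x • s = δ := hx
      have hx₀' : x₀ • s = δ := hx₀
      change (x₀⁻¹ * x) • s = s
      rw [mul_smul, hx', ← hx₀', inv_smul_smul]
    exact (Set.ncard_le_ncard hsub (Set.toFinite _)).trans
      ((Set.ncard_image_le (Set.toFinite _)).trans (by rw [← Nat.card_coe_set_eq]; exact le_rfl))

theorem natCard_map_stabilizer_smul (π : X →* T) (x : X) (w : V) :
    Nat.card ((MulAction.stabilizer X (x • w)).map π) =
      Nat.card ((MulAction.stabilizer X w).map π) := by
  rw [map_stabilizer_smul]
  exact (Nat.card_congr (Subgroup.equivMapOfInjective _ _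
    (MulAut.conj (π x)).injective).toEquiv).symm

/-- An element fixing `α'` sends `α` to one of the at most `d` neighbours of `α'`, and each target
contributes at most one coset. -/
theorem natCard_map_stabilizer_le [Finite V] [Finite T] {Γ : SimpleGraph V} {d : ℕ}
    (hadj : ∀ (x : X) u v, Γ.Adj (x • u) (x • v) ↔ Γ.Adj u v)
    (hval : ∀ v, (Γ.neighborSet v).ncard ≤ d) (π : X →* T) {α α' : V} (hα : Γ.Adj α α') :
    Nat.card ((MulAction.stabilizer X α').map π) ≤
      d * Nat.card ((MulAction.stabilizer X α).map π) := by
  have hsub : ((MulAction.stabilizer X α').map π : Set T) ⊆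
      ⋃ δ ∈ Γ.neighborSet α', π '' {x : X | x • α = δ} := by
    rintro _ ⟨x, hx, rfl⟩
    have hx' : x • α' = α' := hx
    refine Set.mem_biUnion (x := x • α) ?_ ⟨x, rfl, rfl⟩
    rw [SimpleGraph.mem_neighborSet]
    conv_lhs => rw [← hx']
    exact (hadj x _ _).2 hα.symm
  have hfin : (Γ.neighborSet α').Finite := Set.toFinite _
  calc Nat.card ((MulAction.stabilizer X α').map π)
      = ((MulAction.stabilizer X α').map π : Set T).ncard := by
        rw [← Nat.card_coe_set_eq]; rfl
    _ ≤ (⋃ δ ∈ Γ.neighborSet α', π '' {x : X | x • α = δ}).ncard :=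
        Set.ncard_le_ncard hsub (Set.toFinite _)
    _ = (⋃ δ ∈ hfin.toFinset, π '' {x : X | x • α = δ}).ncard := by simp
    _ ≤ ∑ δ ∈ hfin.toFinset, (π '' {x : X | x • α = δ}).ncard :=
        Finset.set_ncard_biUnion_le _ _
    _ ≤ ∑ δ ∈ hfin.toFinset, Nat.card ((MulAction.stabilizer X α).map π) :=
        Finset.sum_le_sum fun δ _ => ncard_image_transporter_le π α δ
    _ ≤ d * Nat.card ((MulAction.stabilizer X α).map π) := by
        rw [Finset.sum_const, smul_eq_mul, ← Set.ncard_eq_toFinset_card _ hfin]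
        exact Nat.mul_le_mul_right _ (hval _)

/-- The number of coordinates is bounded by the valency and the projected stabiliser, when the
coordinates are permuted transitively by symmetries fixing `α`. -/
theorem card_coordinates_le_of_connected [Finite V] [Finite T] {l d : ℕ} {Γ : SimpleGraph V}
    (hconn : Γ.Connected) (hadj : ∀ (x : X) u v, Γ.Adj (x • u) (x • v) ↔ Γ.Adj u v)
    (hval : ∀ v, (Γ.neighborSet v).ncard ≤ d) {α α' : V} (hα : Γ.Adj α α')
    (hne : α' ∉ MulAction.orbit X α)
    (horb : ∀ v, v ∉ MulAction.orbit X α → v ∈ MulAction.orbit X α')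
    (hbal : (Γ.neighborSet α \ MulAction.orbit X α).ncard +
      (Γ.neighborSet α' \ MulAction.orbit X α).ncard ≤ d)
    (p : X →* (Fin l → T)) (hp : Function.Surjective p)
    (hsym : ∀ i j, ∃ (σ : Γ ≃g Γ) (c : X ≃* X) (τ : T ≃* T), σ α = α ∧
      (∀ m v, σ (m • v) = c m • σ v) ∧ ∀ m, p (c m) j = τ (p m i))
    (i : Fin l)
    (htop : (MulAction.stabilizer X α).map ((Pi.evalMonoidHom (fun _ => T) i).comp p) ≠ ⊤) :
    2 ≤ d ∧ l ≤ d ^ d * (d - 1) ^ (2 * (d - 1)) *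
      Nat.card ((MulAction.stabilizer X α).map ((Pi.evalMonoidHom (fun _ => T) i).comp p)) ^
        (2 * (d - 1) + 1) := by
  classical
  have := Fintype.ofFinite V
  have := Fintype.ofFinite T
  let π : Fin l → X →* T := fun j => (Pi.evalMonoidHom (fun _ => T) j).comp p
  have hπ : ∀ j x, π j x = p x j := fun _ _ => rfl
  set u := Nat.card ((MulAction.stabilizer X α).map (π i)) with hu
  set u' := Nat.card ((MulAction.stabilizer X α').map (π i)) with hu'
  have hupos : 0 < u := Nat.card_pos
  have huu' : u' ≤ d * u := natCard_map_stabilizer_le hadj hval (π i) hα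
  choose σ c τ hσα hσ hc using hsym i
  let src : V → V := fun v => if v ∈ MulAction.orbit X α then α else α'
  have hμ : ∀ v, ∃ x : X, x • src v = v := by
    intro v
    by_cases hv : v ∈ MulAction.orbit X α
    · simp only [src, if_pos hv]; exact hv
    · simp only [src, if_neg hv]; exact horb v hv
  choose μ hμ using hμ
  let nb : V → Finset V := fun v => (Γ.neighborSet v).toFinset
  have hnb : ∀ v w, w ∈ nb v ↔ Γ.Adj v w := fun v w => by simp [nb]
  have hnbcard : ∀ v, (nb v).card ≤ d := fun v => by
    rw [← Set.ncard_eq_toFinset_card']; exact hval v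
  -- Erasing the two ends of the base edge is what gives `2 * (d - 1)` generators instead of `2 *
  -- d`.
  let N : Finset V := (nb α).erase α' ∪ (nb α').erase α
  have hNcard : N.card ≤ 2 * (d - 1) := by
    refine (Finset.card_union_le _ _).trans ?_
    rw [Finset.card_erase_of_mem ((hnb _ _).2 hα), Finset.card_erase_of_mem ((hnb _ _).2 hα.symm)]
    have h1 := hnbcard α
    have h2 := hnbcard α'
    omega
  let Q : Subgroup X := Subgroup.closure (μ '' N)
  have hQ : ∀ v, ∃ q ∈ Q, q • α = v ∨ q • α' = v := by
    refine exists_mem_smul_eq_of_connected hconn hadj Q ?_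
    intro β hβ
    by_cases h1 : β = α
    · exact ⟨1, one_mem _, Or.inl (by rw [one_smul, h1])⟩
    by_cases h2 : β = α'
    · exact ⟨1, one_mem _, Or.inr (by rw [one_smul, h2])⟩
    have hβN : β ∈ N := by
      simp only [N, Finset.mem_union, Finset.mem_erase, hnb]
      tauto
    refine ⟨μ β, Subgroup.subset_closure ⟨β, hβN, rfl⟩, ?_⟩
    have := hμ β
    by_cases hv : β ∈ MulAction.orbit X α
    · left; rwa [show src β = α from if_pos hv] at this
    · right; rwa [show src β = α' from if_neg hv] at this
  have hQY : ∀ m : X, ∃ q ∈ Q, q⁻¹ * m ∈ MulAction.stabilizer X α := by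
    intro m
    obtain ⟨q, hq, h | h⟩ := hQ (m • α)
    · exact ⟨q, hq, by rw [MulAction.mem_stabilizer_iff, mul_smul, ← h, inv_smul_smul]⟩
    · exact absurd ⟨q⁻¹ * m, by
        change (q⁻¹ * m) • α = α'
        rw [mul_smul, ← h, inv_smul_smul]⟩ hne
  -- For `d ≤ 1` there are no generators, so `Q` is trivial and the stabiliser of `α` is all of `X`,
  -- against `htop`.
  have hd : 2 ≤ d := by
    by_contra hd
    have hN : N = ∅ := Finset.card_eq_zero.1 (by omega)
    refine htop (eq_top_iff.2 fun t _ => ?_)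
    obtain ⟨m, hm⟩ := hp (fun _ => t)
    obtain ⟨q, hq, hqm⟩ := hQY m
    have hq1 : q = 1 := by simpa [Q, hN] using hq
    refine ⟨m, by simpa [hq1] using hqm, ?_⟩
    exact congrFun hm i
  refine ⟨hd, ?_⟩
  have hstab : ∀ j, (MulAction.stabilizer X α).map (π j) =
      ((MulAction.stabilizer X α).map (π i)).map (τ j).toMonoidHom := by
    intro j
    ext t
    constructor
    · rintro ⟨m, hm, rfl⟩
      refine ⟨π i ((c j).symm m), ⟨(c j).symm m, ?_, rfl⟩, ?_⟩
      · have hm' : m • α = α := hm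
        refine (σ j).injective ?_
        rw [hσ, MulEquiv.apply_symm_apply, hσα, hm']
      · change τ j (p ((c j).symm m) i) = p m j
        rw [← hc, MulEquiv.apply_symm_apply]
    · rintro ⟨_, ⟨m, hm, rfl⟩, rfl⟩
      refine ⟨c j m, ?_, hc j m⟩
      have hm' : m • α = α := hm
      change c j m • α = α
      conv_lhs => rw [← hσα j]
      rw [← hσ, hm', hσα]
  have hucard : ∀ j, Nat.card ((MulAction.stabilizer X α).map (π j)) = u := by
    intro j
    rw [hstab j]
    exact (Nat.card_congr (Subgroup.equivMapOfInjective _ _ (τ j).injective).toEquiv).symm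
  have hjtop : ∀ j, (MulAction.stabilizer X α).map (π j) ≠ ⊤ := by
    intro j hj
    refine htop (eq_top_iff.2 fun t _ => ?_)
    have : τ j t ∈ (MulAction.stabilizer X α).map (π j) := hj ▸ Subgroup.mem_top _
    rw [hstab j] at this
    obtain ⟨s, hs, hst⟩ := this
    rwa [← (τ j).injective hst]
  have hsrcσ : ∀ j v, v ∈ MulAction.orbit X α → (σ j).symm v ∈ MulAction.orbit X α := by
    rintro j _ ⟨m, rfl⟩
    refine ⟨(c j).symm m, (σ j).injective ?_⟩
    change σ j ((c j).symm m • α) = _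
    rw [hσ, MulEquiv.apply_symm_apply, hσα, RelIso.apply_symm_apply]
  have hsrcσ' : ∀ j v, v ∉ MulAction.orbit X α → (σ j).symm v ∉ MulAction.orbit X α := by
    rintro j v hv ⟨m, hm⟩
    refine hv ⟨c j m, ?_⟩
    have hm' : m • α = (σ j).symm v := hm
    have := congrArg (σ j) hm'
    rw [hσ, hσα, RelIso.apply_symm_apply] at this
    exact this
  -- The code of `j` records, up to `τ j`, the `j`-th coordinates of the generators of `Q`. On a
  -- fibre of `code` the maps `π i ∘ (c j).symm` agree on generators, hence on `Q`.
  let code : Fin l → (N → T) := fun j β => π i ((c j).symm (μ β))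
  have hfiber : ∀ z ∈ Finset.univ.image code,
      (Finset.univ.filter fun j => code j = z).card ≤ u := by
    intro z hz
    obtain ⟨j₀, -, rfl⟩ := Finset.mem_image.1 hz
    refine card_coordinates_le p hp Q (MulAction.stabilizer X α) hQY u _ (fun j _ => hucard j)
      (fun j _ => hjtop j) (fun q => π i ((c j₀).symm q)) (fun j => τ j) ?_
    intro j hj q hq
    have hcode : code j = code j₀ := (Finset.mem_filter.1 hj).2
    have heq : Q ≤ ((π i).comp (c j).symm.toMonoidHom).eqLocus
        ((π i).comp (c j₀).symm.toMonoidHom) := by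
      rw [Subgroup.closure_le]
      rintro _ ⟨β, hβ, rfl⟩
      exact congrFun hcode ⟨β, hβ⟩
    have hq' : π i ((c j).symm q) = π i ((c j₀).symm q) := heq hq
    rw [← hq', hπ, ← hc, MulEquiv.apply_symm_apply]
  let w : V → ℕ := fun β => if β ∈ MulAction.orbit X α then u else u'
  -- Here `γ` stands for `(σ j).symm α'`. As `(σ j).symm` fixes `α`, it sends `β ∈ N` to a neighbour
  -- of `α` other than `γ`, or to a neighbour of `γ` other than `α`: at most `d - 1` targets.
  let tgt : V → V → Finset V := fun γ β =>
    if Γ.Adj α β ∧ β ≠ α' then (nb α).erase γ else (nb γ).erase α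
  let vals : V → V → Finset T := fun γ β => (tgt γ β).biUnion fun δ =>
    (π i '' {x : X | x • (if β ∈ MulAction.orbit X α then α else γ) = δ}).toFinset
  let cross : Finset V := (nb α).filter fun v => v ∉ MulAction.orbit X α
  have hvals : ∀ γ ∈ cross, ∀ β, (vals γ β).card ≤ (d - 1) * w β := by
    intro γ hγ β
    obtain ⟨hγα, hγo⟩ := Finset.mem_filter.1 hγ
    have hγα' : α ∈ nb γ := (hnb _ _).2 ((hnb _ _).1 hγα).symm
    have hw : Nat.card ((MulAction.stabilizer X
        (if β ∈ MulAction.orbit X α then α else γ)).map (π i)) = w β := by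
      by_cases hβ : β ∈ MulAction.orbit X α
      · simp only [w, if_pos hβ, hu]
      · obtain ⟨x, rfl⟩ := horb γ hγo
        simp only [w, if_neg hβ]
        exact natCard_map_stabilizer_smul (π i) x α'
    have htgt : (tgt γ β).card ≤ d - 1 := by
      by_cases hβ : Γ.Adj α β ∧ β ≠ α'
      · simp only [tgt, if_pos hβ]
        rw [Finset.card_erase_of_mem hγα]
        exact Nat.sub_le_sub_right (hnbcard α) 1
      · simp only [tgt, if_neg hβ]
        rw [Finset.card_erase_of_mem hγα']
        exact Nat.sub_le_sub_right (hnbcard γ) 1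
    refine (Finset.card_biUnion_le_card_mul _ _ (w β) fun δ _ => ?_).trans
      (Nat.mul_le_mul_right _ htgt)
    rw [← Set.ncard_eq_toFinset_card', ← hw]
    exact ncard_image_transporter_le (π i) _ δ
  -- The element `(c j).symm (μ β)` maps `α` or `γ`, according to the orbit of `β`, to `(σ j).symm
  -- β`. So a code is fixed by the choice of `γ`, a target for each `β`, and an element of a coset.
  have hcodes : Finset.univ.image code ⊆
      cross.biUnion fun γ => Fintype.piFinset fun β : N => vals γ β := by
    intro z hz
    obtain ⟨j, -, rfl⟩ := Finset.mem_image.1 hz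
    have hσα' : (σ j).symm α = α := by
      conv_lhs => rw [← hσα j]
      exact (σ j).symm_apply_apply α
    have hadjσ : ∀ a b, Γ.Adj a b → Γ.Adj ((σ j).symm a) ((σ j).symm b) :=
      fun a b hab => (σ j).symm.map_rel_iff.2 hab
    refine Finset.mem_biUnion.2 ⟨(σ j).symm α', Finset.mem_filter.2 ⟨?_, hsrcσ' j _ hne⟩,
      Fintype.mem_piFinset.2 fun β => ?_⟩
    · rw [hnb]; simpa [hσα'] using hadjσ _ _ hα
    · refine Finset.mem_biUnion.2 ⟨(σ j).symm β, ?_, Set.mem_toFinset.2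
        ⟨(c j).symm (μ β), ?_, rfl⟩⟩
      · obtain ⟨β, hβ⟩ := β
        simp only [N, Finset.mem_union, Finset.mem_erase, hnb] at hβ
        by_cases hb : Γ.Adj α β ∧ β ≠ α'
        · simp only [tgt, if_pos hb, Finset.mem_erase, hnb]
          exact ⟨fun h => hb.2 ((σ j).symm.injective h), by
            simpa [hσα'] using hadjσ _ _ hb.1⟩
        · simp only [tgt, if_neg hb, Finset.mem_erase, hnb]
          have hβ' : β ≠ α ∧ Γ.Adj α' β := by tauto
          exact ⟨fun h => hβ'.1 ((σ j).symm.injective (h.trans hσα'.symm)), hadjσ _ _ hβ'.2⟩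
      · change (c j).symm (μ β) • _ = (σ j).symm β
        refine (σ j).injective ?_
        rw [hσ, MulEquiv.apply_symm_apply, RelIso.apply_symm_apply]
        have hb := hμ β
        by_cases hβ : (β : V) ∈ MulAction.orbit X α
        · rw [if_pos hβ, hσα]
          rwa [show src β = α from if_pos hβ] at hb
        · rw [if_neg hβ, RelIso.apply_symm_apply]
          rwa [show src β = α' from if_neg hβ] at hb
  -- Only these generators start at `α'` and cost `u' ≤ d * u` instead of `u`. By `hbal` there are
  -- at most `d` such neighbours, and `α'` itself, which is not in `N`, is among those counted.
  have hBcard : (N.filter fun v => v ∉ MulAction.orbit X α).card ≤ d - 1 := by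
    have hsub : (N.filter fun v => v ∉ MulAction.orbit X α) ⊆
        ((nb α).filter fun v => v ∉ MulAction.orbit X α).erase α' ∪
          (nb α').filter fun v => v ∉ MulAction.orbit X α := by
      intro v hv
      simp only [N, Finset.mem_filter, Finset.mem_union, Finset.mem_erase] at hv ⊢
      tauto
    have h1 : ((nb α).filter fun v => v ∉ MulAction.orbit X α).card =
        (Γ.neighborSet α \ MulAction.orbit X α).ncard := by
      rw [← Set.ncard_coe_finset]; congr 1; ext v; simp [hnb]
    have h2 : ((nb α').filter fun v => v ∉ MulAction.orbit X α).card =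
        (Γ.neighborSet α' \ MulAction.orbit X α).ncard := by
      rw [← Set.ncard_coe_finset]; congr 1; ext v; simp [hnb]
    have h3 := (Finset.card_le_card hsub).trans (Finset.card_union_le _ _)
    have hmem : α' ∈ (nb α).filter fun v => v ∉ MulAction.orbit X α :=
      Finset.mem_filter.2 ⟨(hnb _ _).2 hα, hne⟩
    rw [Finset.card_erase_of_mem hmem] at h3
    have h4 : 0 < ((nb α).filter fun v => v ∉ MulAction.orbit X α).card :=
      Finset.card_pos.2 ⟨_, hmem⟩
    omega
  have hprod : ∏ β : N, (d - 1) * w β ≤ ((d - 1) * u) ^ (2 * (d - 1)) * d ^ (d - 1) := by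
    rw [Finset.prod_coe_sort N (fun β => (d - 1) * w β)]
    calc ∏ β ∈ N, (d - 1) * w β
        ≤ ∏ β ∈ N, ((d - 1) * u) * (if β ∉ MulAction.orbit X α then d else 1) := by
          refine Finset.prod_le_prod' fun β _ => ?_
          by_cases hβ : β ∈ MulAction.orbit X α
          · simp [w, hβ]
          · simp only [w, hβ, if_false, not_false_eq_true, if_true, mul_assoc]
            exact Nat.mul_le_mul_left _ (huu'.trans_eq (mul_comm d u))
      _ = ((d - 1) * u) ^ N.card * d ^ (N.filter fun v => v ∉ MulAction.orbit X α).card := by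
          rw [Finset.prod_mul_distrib, Finset.prod_const, ← Finset.prod_filter, Finset.prod_const]
      _ ≤ _ := Nat.mul_le_mul
          (Nat.pow_le_pow_right (Nat.mul_pos (by omega) hupos) hNcard)
          (Nat.pow_le_pow_right (by omega) hBcard)
  have himage : (Finset.univ.image code).card ≤
      d * (((d - 1) * u) ^ (2 * (d - 1)) * d ^ (d - 1)) := by
    refine (Finset.card_le_card hcodes).trans ?_
    refine (Finset.card_biUnion_le_card_mul _ _ _ fun γ hγ => ?_).trans
      (Nat.mul_le_mul_right _ ((Finset.card_filter_le _ _).trans (hnbcard α)))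
    rw [Fintype.card_piFinset]
    exact (Finset.prod_le_prod' fun (β : N) _ => hvals γ hγ (β : V)).trans hprod
  have hl := Finset.card_le_mul_card_image (f := code) Finset.univ u hfiber
  rw [Finset.card_univ, Fintype.card_fin] at hl
  -- The factor `d ^ d` combines the `d` choices of `γ` with the `d ^ (d - 1)` from `hBcard`; the
  -- extra factor `u` is the bound on the fibres of `code`.
  refine hl.trans ((Nat.mul_le_mul_left u himage).trans_eq ?_)
  obtain ⟨e, rfl⟩ : ∃ e, d = e + 1 := ⟨d - 1, by omega⟩
  simp only [Nat.add_sub_cancel]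
  rw [mul_pow, pow_succ (e + 1) e, pow_succ u]
  ring

end CoordinateBound

/-! ### The two halves and the graph Γ^Δ -/

section Halves

variable {V G : Type*} [Group G] [MulAction G V]

theorem distTwoGraph_adj_iff {Γ : SimpleGraph V} {Δ : Set V} {u v : Δ} :
    (distTwoGraph Γ Δ).Adj u v ↔
      u ≠ v ∧ (Γ.Adj u v ∨ ∃ w, Γ.Adj u w ∧ Γ.Adj w v) := by
  obtain ⟨u, hu⟩ := u
  obtain ⟨v, hv⟩ := v
  change _ ∧ Γ.edist u v ≤ 2 ↔ _
  refine and_congr_right fun huv => ?_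
  constructor
  · intro h
    obtain ⟨p, hp⟩ := SimpleGraph.exists_walk_of_edist_ne_top (G := Γ) (u := u)
      (v := v) (ne_top_of_le_ne_top (by decide) h)
    rw [← hp] at h
    have h2 : p.length ≤ 2 := by exact_mod_cast h
    cases p with
    | nil => exact absurd rfl huv
    | cons h₁ q =>
      cases q with
      | nil => exact Or.inl h₁
      | cons h₂ q =>
        cases q with
        | nil => exact Or.inr ⟨_, h₁, h₂⟩
        | cons h₃ q => simp at h2
  · rintro (h | ⟨w, h₁, h₂⟩)
    · exact (SimpleGraph.edist_le h.toWalk).trans (by simp)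
    · exact (SimpleGraph.edist_le (.cons h₁ (.cons h₂ .nil))).trans (by simp)

/-- A walk alternates between `Δ` and its complement, so its visits to `Δ` are two steps apart. The
induction carries, at a vertex outside `Δ`, any neighbour in `Δ` as a stand-in. -/
theorem distTwoGraph_connected {Γ : SimpleGraph V} (hconn : Γ.Connected) {Δ : Set V}
    (hΔ : Δ.Nonempty) (hbip : ∀ u v, Γ.Adj u v → (u ∈ Δ ↔ v ∉ Δ)) :
    (distTwoGraph Γ Δ).Connected := by
  have hstep : ∀ (a b : Δ), (∃ w, Γ.Adj a w ∧ Γ.Adj w b) → (distTwoGraph Γ Δ).Reachable a b := by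
    intro a b h
    by_cases hab : a = b
    · rw [hab]
    · exact (distTwoGraph_adj_iff.2 ⟨hab, Or.inr h⟩).reachable
  have hwalk : ∀ (u v : V), Γ.Walk u v → ∀ b : Δ, (b : V) = v →
      (∀ a : Δ, (a : V) = u → (distTwoGraph Γ Δ).Reachable a b) ∧
      (u ∉ Δ → ∀ a : Δ, Γ.Adj a u → (distTwoGraph Γ Δ).Reachable a b) := by
    intro u v p
    induction p with
    | nil =>
      rintro b rfl
      exact ⟨fun a ha => by rw [Subtype.ext ha], fun h => absurd b.2 h⟩
    | @cons u v w huv p ih =>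
      intro b hb
      obtain ⟨ih₁, ih₂⟩ := ih b hb
      constructor
      · rintro a rfl
        exact ih₂ ((hbip _ _ huv).1 a.2) a huv
      · intro hu a ha
        have hv : v ∈ Δ := by
          by_contra hv
          exact hu ((hbip _ _ huv).2 hv)
        exact (hstep a ⟨v, hv⟩ ⟨u, ha, huv⟩).trans (ih₁ ⟨v, hv⟩ rfl)
  obtain ⟨x, hx⟩ := hΔ
  have : Nonempty Δ := ⟨⟨x, hx⟩⟩
  refine ⟨fun a b => ?_⟩
  obtain ⟨p⟩ := hconn.preconnected (a : V) b
  exact (hwalk _ _ p b rfl).1 a rfl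

theorem orbit_smul_eq_smul_orbit (N : Subgroup G) [hN : N.Normal] (x : G) (v : V) :
    MulAction.orbit N (x • v) = x • MulAction.orbit N v := by
  ext w
  rw [Set.mem_smul_set_iff_inv_smul_mem]
  constructor
  · rintro ⟨n, rfl⟩
    refine ⟨⟨x⁻¹ * n * x, by simpa using hN.conj_mem n n.2 x⁻¹⟩, ?_⟩
    change (x⁻¹ * n * x) • v = x⁻¹ • (n : G) • x • v
    simp only [mul_smul]
  · rintro ⟨n, hn⟩
    have hn' : (n : G) • v = x⁻¹ • w := hn
    refine ⟨⟨x * n * x⁻¹, hN.conj_mem n n.2 x⟩, ?_⟩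
    change (x * n * x⁻¹) • x • v = w
    rw [mul_smul, mul_smul, inv_smul_smul, hn', smul_inv_smul]

theorem IsHalf.nonempty {Δ : Set V} (h : IsHalf G Δ) : Δ.Nonempty := by
  obtain ⟨N, -, -, -, α, rfl⟩ := h
  exact ⟨α, MulAction.mem_orbit_self α⟩

theorem IsHalf.exists_notMem {Δ : Set V} (h : IsHalf G Δ) : ∃ v, v ∉ Δ := by
  obtain ⟨N, -, -, hN, α, rfl⟩ := h
  by_contra! hall
  refine hN ⟨fun u v => ?_⟩
  have huv : MulAction.orbit N u = MulAction.orbit N α := MulAction.orbit_eq_iff.2 (hall u)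
  have := hall v
  rw [← huv] at this
  exact this

/-- A translate of an orbit of the normal subgroup `N` is again an `N`-orbit; if it were neither `Δ`
nor the complement, `N` would have three orbits. -/
theorem IsHalf.smul_eq_or [Finite V] (hG : IsBiquasiprimitive G V) {Δ : Set V}
    (h : IsHalf G Δ) (x : G) : x • Δ = Δ ∨ x • Δ = Δᶜ := by
  obtain ⟨N, hN, hbot, -, α, rfl⟩ := h
  rw [← orbit_smul_eq_smul_orbit]
  by_cases hx : x • α ∈ MulAction.orbit N α
  · exact Or.inl (MulAction.orbit_eq_iff.2 hx)
  right
  ext w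
  constructor
  · rintro hw hw'
    exact hx (MulAction.orbit_eq_iff.1
      ((MulAction.orbit_eq_iff.2 hw).symm.trans (MulAction.orbit_eq_iff.2 hw')))
  · intro hw
    by_contra hw'
    let q : V → MulAction.orbitRel.Quotient N V := Quotient.mk''
    have hq : ∀ a b, q a = q b → a ∈ MulAction.orbit N b := fun a b hab => Quotient.exact' hab
    have hfin : Finite (MulAction.orbitRel.Quotient N V) := Quotient.finite _
    classical
    have := Fintype.ofFinite (MulAction.orbitRel.Quotient N V)
    have hle := hG.2 N hN hbot
    have hthree : ({q α, q (x • α), q w} : Finset (MulAction.orbitRel.Quotient N V)).card = 3 := by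
      refine Finset.card_eq_three.2 ⟨_, _, _, fun h => hx (hq _ _ h.symm),
        fun h => hw (hq _ _ h.symm), fun h => hw' (hq _ _ h.symm), rfl⟩
    have := Finset.card_le_univ ({q α, q (x • α), q w} : Finset (MulAction.orbitRel.Quotient N V))
    rw [← Nat.card_eq_fintype_card] at this
    omega

section SmulEqOr

variable {Δ : Set V}

theorem smul_eq_compl_of_notMem_plus (hΔ : ∀ x : G, x • Δ = Δ ∨ x • Δ = Δᶜ)
    {x : G} (hx : x ∉ plus G Δ) : x • Δ = Δᶜ :=
  (hΔ x).resolve_left hx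

theorem smul_mem_iff_smul_mem (hΔ : ∀ x : G, x • Δ = Δ ∨ x • Δ = Δᶜ)
    (x : G) (u v : V) :
    (x • u ∈ Δ ↔ x • v ∈ Δ) ↔ (u ∈ Δ ↔ v ∈ Δ) := by
  have hmem : ∀ w : V, x • w ∈ Δ ↔ w ∈ x⁻¹ • Δ := fun w => by
    rw [Set.mem_inv_smul_set_iff]
  rw [hmem, hmem]
  rcases hΔ x⁻¹ with h | h <;> rw [h]
  simp only [Set.mem_compl_iff, not_iff_not]

theorem map_conj_plus (hΔ : ∀ x : G, x • Δ = Δ ∨ x • Δ = Δᶜ)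
    (x : G) : (plus G Δ).map (MulAut.conj x).toMonoidHom = plus G Δ := by
  rw [← MulAction.stabilizer_smul_eq_stabilizer_map_conj]
  rcases hΔ x with h | h <;> rw [h]
  ext y
  rw [MulAction.mem_stabilizer_iff, MulAction.mem_stabilizer_iff, Set.smul_set_compl,
    compl_inj_iff]

variable {d : ℕ} {Γ : SimpleGraph V}

theorem ncard_adj_same_eq (hΔ : ∀ x : G, x • Δ = Δ ∨ x • Δ = Δᶜ)
    (hΓ : InFamilyA d Γ (MulAction.toPermHom G V))
    (u v : V) :
    {w | Γ.Adj u w ∧ (w ∈ Δ ↔ u ∈ Δ)}.ncard = {w | Γ.Adj v w ∧ (w ∈ Δ ↔ v ∈ Δ)}.ncard := by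
  obtain ⟨x, rfl⟩ := hΓ.transitive u v
  have hadj : ∀ a b, Γ.Adj (x • a) (x • b) ↔ Γ.Adj a b := hΓ.adj_iff x
  rw [← Set.ncard_image_of_injective _ (MulAction.injective x)]
  congr 1
  ext w
  change _ ↔ Γ.Adj (x • u) w ∧ (w ∈ Δ ↔ x • u ∈ Δ)
  constructor
  · rintro ⟨z, ⟨hz, hz'⟩, rfl⟩
    exact ⟨(hadj _ _).2 hz, (smul_mem_iff_smul_mem hΔ x z u).2 hz'⟩
  · rintro ⟨hw, hw'⟩
    refine ⟨x⁻¹ • w, ⟨?_, ?_⟩, smul_inv_smul x w⟩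
    · rwa [← hadj, smul_inv_smul]
    · rwa [← smul_mem_iff_smul_mem hΔ x, smul_inv_smul]

theorem ncard_adj_cross_eq (hΔ : ∀ x : G, x • Δ = Δ ∨ x • Δ = Δᶜ)
    (hΓ : InFamilyA d Γ (MulAction.toPermHom G V))
    (u v : V) :
    {w | Γ.Adj u w ∧ ¬ (w ∈ Δ ↔ u ∈ Δ)}.ncard = {w | Γ.Adj v w ∧ ¬ (w ∈ Δ ↔ v ∈ Δ)}.ncard := by
  obtain ⟨x, rfl⟩ := hΓ.transitive u v
  have hadj : ∀ a b, Γ.Adj (x • a) (x • b) ↔ Γ.Adj a b := hΓ.adj_iff x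
  rw [← Set.ncard_image_of_injective _ (MulAction.injective x)]
  congr 1
  ext w
  change _ ↔ Γ.Adj (x • u) w ∧ ¬ (w ∈ Δ ↔ x • u ∈ Δ)
  constructor
  · rintro ⟨z, ⟨hz, hz'⟩, rfl⟩
    exact ⟨(hadj _ _).2 hz, fun h => hz' ((smul_mem_iff_smul_mem hΔ x z u).1 h)⟩
  · rintro ⟨hw, hw'⟩
    refine ⟨x⁻¹ • w, ⟨?_, ?_⟩, smul_inv_smul x w⟩
    · rwa [← hadj, smul_inv_smul]
    · rwa [← smul_mem_iff_smul_mem hΔ x, smul_inv_smul]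

theorem ncard_adj_same_add_cross (hΓ : InFamilyA d Γ (MulAction.toPermHom G V))
    (u : V) :
    {w | Γ.Adj u w ∧ (w ∈ Δ ↔ u ∈ Δ)}.ncard + {w | Γ.Adj u w ∧ ¬ (w ∈ Δ ↔ u ∈ Δ)}.ncard ≤ d := by
  have := hΓ.finite
  rw [← Set.ncard_union_eq ?_ (Set.toFinite _) (Set.toFinite _)]
  · refine (Set.ncard_le_ncard ?_ (Set.toFinite _)).trans (hΓ.valency_le u)
    rintro w (h | h) <;> exact h.1
  · rw [Set.disjoint_left]
    exact fun w h h' => h'.2 h.2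

theorem exists_adj_cross (hΓ : InFamilyA d Γ (MulAction.toPermHom G V))
    (hne : Δ.Nonempty) (hne' : ∃ v, v ∉ Δ) :
    ∃ u ∈ Δ, ∃ v ∉ Δ, Γ.Adj u v := by
  obtain ⟨a, ha⟩ := hne
  obtain ⟨b, hb⟩ := hne'
  obtain ⟨p⟩ := hΓ.connected.preconnected a b
  obtain ⟨e, -, h₁, h₂⟩ := p.exists_boundary_dart Δ ha hb
  exact ⟨_, h₁, _, h₂, e.adj⟩

theorem ncard_neighborSet_distTwoGraph_le (hΔ : ∀ x : G, x • Δ = Δ ∨ x • Δ = Δᶜ)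
    (hΓ : InFamilyA d Γ (MulAction.toPermHom G V))
    (hne : Δ.Nonempty) (hne' : ∃ v, v ∉ Δ) (α : Δ) :
    ((distTwoGraph Γ Δ).neighborSet α).ncard ≤ d * (d - 1) := by
  have := hΓ.finite
  let same : V → Set V := fun u => {w | Γ.Adj u w ∧ (w ∈ Δ ↔ u ∈ Δ)}
  let cross : V → Set V := fun u => {w | Γ.Adj u w ∧ ¬ (w ∈ Δ ↔ u ∈ Δ)}
  set a := (same α).ncard with ha
  set b := (cross α).ncard with hb
  have hsame : ∀ u, (same u).ncard = a := fun u => ncard_adj_same_eq hΔ hΓ u α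
  have hcross : ∀ u, (cross u).ncard = b := fun u => ncard_adj_cross_eq hΔ hΓ u α
  have hab : a + b ≤ d := ncard_adj_same_add_cross hΓ (α : V)
  have hbpos : 1 ≤ b := by
    obtain ⟨u, hu, v, hv, huv⟩ := exists_adj_cross hΓ hne hne'
    rw [← hcross u]
    exact (Set.ncard_pos (Set.toFinite _)).2 ⟨v, huv, fun h => hv (h.2 hu)⟩
  -- A path of length two between vertices of `Δ` crosses between the halves either never or twice,
  -- so no mixed terms occur.
  have hsub : (Subtype.val '' (distTwoGraph Γ Δ).neighborSet α : Set V) ⊆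
      same α ∪ ((⋃ u ∈ (same α).toFinite.toFinset, same u \ {(α : V)}) ∪
        ⋃ u ∈ (cross α).toFinite.toFinset, cross u \ {(α : V)}) := by
    rintro _ ⟨v, hv, rfl⟩
    obtain ⟨hne, h | ⟨w, h₁, h₂⟩⟩ := distTwoGraph_adj_iff.1 hv
    · exact Or.inl ⟨h, iff_of_true v.2 α.2⟩
    · right
      have hvα : (v : V) ≠ α := fun h => hne (Subtype.ext h.symm)
      by_cases hw : w ∈ Δ
      · left
        exact Set.mem_biUnion (x := w) (by simpa [same] using ⟨h₁, hw⟩)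
          ⟨⟨h₂, iff_of_true v.2 hw⟩, hvα⟩
      · right
        exact Set.mem_biUnion (x := w) (by simpa [cross] using ⟨h₁, hw⟩)
          ⟨⟨h₂, fun h => hw (h.1 v.2)⟩, hvα⟩
  have hs : ∀ u ∈ (same α).toFinite.toFinset, (same u \ {(α : V)}).ncard ≤ a - 1 := by
    intro u hu
    have hu' : Γ.Adj α u ∧ (u ∈ Δ ↔ (α : V) ∈ Δ) := by simpa [same] using hu
    rw [Set.ncard_sdiff_singleton_of_mem (show (α : V) ∈ same u from ⟨hu'.1.symm, hu'.2.symm⟩),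
      hsame]
  have hc : ∀ u ∈ (cross α).toFinite.toFinset, (cross u \ {(α : V)}).ncard ≤ b - 1 := by
    intro u hu
    have hu' : u ∈ cross α := (Set.Finite.mem_toFinset _).1 hu
    rw [Set.ncard_sdiff_singleton_of_mem
      (show (α : V) ∈ cross u from ⟨hu'.1.symm, fun h => hu'.2 h.symm⟩), hcross]
  have h1 : (⋃ u ∈ (same α).toFinite.toFinset, same u \ {(α : V)}).ncard ≤ a * (a - 1) := by
    refine (Finset.set_ncard_biUnion_le _ _).trans ((Finset.sum_le_card_nsmul _ _ _ hs).trans_eq ?_)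
    rw [smul_eq_mul, ← Set.ncard_eq_toFinset_card]
  have h2 : (⋃ u ∈ (cross α).toFinite.toFinset, cross u \ {(α : V)}).ncard ≤ b * (b - 1) := by
    refine (Finset.set_ncard_biUnion_le _ _).trans ((Finset.sum_le_card_nsmul _ _ _ hc).trans_eq ?_)
    rw [smul_eq_mul, ← Set.ncard_eq_toFinset_card]
  have h3 : ((distTwoGraph Γ Δ).neighborSet α).ncard ≤ a + (a * (a - 1) + b * (b - 1)) := by
    rw [← Set.ncard_image_of_injective _ Subtype.val_injective]
    refine (Set.ncard_le_ncard hsub (Set.toFinite _)).trans ((Set.ncard_union_le _ _).trans ?_)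
    exact Nat.add_le_add_left ((Set.ncard_union_le _ _).trans (Nat.add_le_add h1 h2)) _
  -- The inequality a + a(a-1) + b(b-1) ≤ (a+b)(a+b-1) amounts to a ≤ 2ab, which holds because b ≥
  -- 1.
  refine h3.trans (le_trans ?_ (Nat.mul_le_mul hab (Nat.sub_le_sub_right hab 1)))
  obtain ⟨b', hb'⟩ : ∃ b', b = b' + 1 := ⟨b - 1, by omega⟩
  rw [hb']
  rcases a with _ | a'
  · simp
  · simp only [Nat.add_sub_cancel, show a' + 1 + (b' + 1) - 1 = a' + 1 + b' by omega]
    nlinarith [Nat.zero_le (a' * b')]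

end SmulEqOr

end Halves

/-! ### Minimal subgroups normalised by a given subgroup, inside the ambient group -/

section MinimalNormalized

variable {G : Type*} [Group G]

/-- `L` is a minimal nontrivial subgroup among the subgroups normalised by `P`, and `L ≤ P`. -/
structure IsMinimalNormalizedBy (P L : Subgroup G) : Prop where
  le : L ≤ P
  ne_bot : L ≠ ⊥
  conj_mem : ∀ x ∈ P, ∀ y ∈ L, x * y * x⁻¹ ∈ L
  eq_bot_or_eq : ∀ K : Subgroup G, K ≤ L → (∀ x ∈ P, ∀ y ∈ K, x * y * x⁻¹ ∈ K) → K = ⊥ ∨ K = L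

theorem IsMinimalNormal.isMinimalNormalizedBy {P : Subgroup G} {R : Subgroup P}
    (h : IsMinimalNormal R) : IsMinimalNormalizedBy P (R.map P.subtype) where
  le := Subgroup.map_subtype_le R
  ne_bot := fun hb => h.2.1 ((Subgroup.map_eq_bot_iff_of_injective _ P.subtype_injective).1 hb)
  conj_mem := by
    rintro x hx _ ⟨y, hy, rfl⟩
    exact ⟨⟨x, hx⟩ * y * ⟨x, hx⟩⁻¹, h.1.conj_mem y hy ⟨x, hx⟩, rfl⟩
  eq_bot_or_eq := by
    intro K hK hconj
    have hKP : K ≤ P := hK.trans (Subgroup.map_subtype_le R)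
    have hmap : (K.subgroupOf P).map P.subtype = K := Subgroup.map_subgroupOf_eq_of_le hKP
    rcases h.2.2 (K.subgroupOf P) ⟨fun y hy x => hconj x x.2 y hy⟩ (fun y hy => by
      obtain ⟨z, hz, hzy⟩ := hK (Subgroup.mem_subgroupOf.1 hy)
      rwa [← Subtype.ext hzy]) with h1 | h1
    · left; rw [← hmap, h1, Subgroup.map_bot]
    · right; rw [← hmap, h1]

theorem IsMinimalNormalizedBy.map_conj {P L : Subgroup G} (h : IsMinimalNormalizedBy P L) (g : G) :
    IsMinimalNormalizedBy (P.map (MulAut.conj g).toMonoidHom)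
      (L.map (MulAut.conj g).toMonoidHom) where
  le := Subgroup.map_mono h.le
  ne_bot := fun hb => h.ne_bot
    ((Subgroup.map_eq_bot_iff_of_injective _ (MulAut.conj g).injective).1 hb)
  conj_mem := by
    rintro _ ⟨x, hx, rfl⟩ _ ⟨y, hy, rfl⟩
    exact ⟨x * y * x⁻¹, h.conj_mem x hx y hy, by simp [mul_assoc]⟩
  eq_bot_or_eq := by
    intro K hK hconj
    have hmap : (K.map (MulAut.conj g⁻¹).toMonoidHom).map (MulAut.conj g).toMonoidHom = K := by
      rw [map_conj_map_conj, mul_inv_cancel, map_conj_one]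
    rcases h.eq_bot_or_eq (K.map (MulAut.conj g⁻¹).toMonoidHom) (by
        refine (Subgroup.map_mono hK).trans ?_
        rw [map_conj_map_conj, inv_mul_cancel, map_conj_one]) (by
        rintro x hx _ ⟨y, hy, rfl⟩
        exact ⟨_, hconj _ ⟨x, hx, rfl⟩ y hy, by simp [mul_assoc]⟩) with h1 | h1
    · left; rw [← hmap, h1, Subgroup.map_bot]
    · right; rw [← hmap, h1]

/-- The intersection is normalised by `P`, hence trivial or equal to both; it contains all
commutators of `L` with `L'`. -/
theorem IsMinimalNormalizedBy.eq_or_commute {P L L' : Subgroup G}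
    (h : IsMinimalNormalizedBy P L) (h' : IsMinimalNormalizedBy P L') :
    L = L' ∨ ∀ x ∈ L, ∀ y ∈ L', x * y = y * x := by
  have hinf : ∀ x ∈ P, ∀ y ∈ L ⊓ L', x * y * x⁻¹ ∈ L ⊓ L' := fun x hx y hy =>
    ⟨h.conj_mem x hx y hy.1, h'.conj_mem x hx y hy.2⟩
  rcases h.eq_bot_or_eq (L ⊓ L') inf_le_left hinf with h1 | h1
  · right
    intro x hx y hy
    have hmem : x * y * x⁻¹ * y⁻¹ ∈ L ⊓ L' := by
      refine Subgroup.mem_inf.2 ⟨?_, mul_mem (h'.conj_mem x (h.le hx) y hy) (inv_mem hy)⟩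
      have := mul_mem hx (h.conj_mem y (h'.le hy) x⁻¹ (inv_mem hx))
      simpa only [mul_assoc] using this
    rw [h1, Subgroup.mem_bot, mul_inv_eq_one, mul_inv_eq_iff_eq_mul] at hmem
    exact hmem
  · left
    rcases h'.eq_bot_or_eq (L ⊓ L') inf_le_right hinf with h2 | h2
    · exact absurd (h1.symm.trans h2) h.ne_bot
    · exact h1.symm.trans h2

end MinimalNormalized

/-! ### The socle, its two minimal factors and their coordinates -/

namespace Decomposition

variable {V G T : Type*} [Group G] [MulAction G V] [Group T] {l : ℕ} (D : Decomposition V G T l)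

/-- The inclusion of `M` in `G`. -/
def incl : D.M →* G := (plus G D.Δ).subtype.comp D.M.subtype

theorem incl_injective : Function.Injective D.incl :=
  (plus G D.Δ).subtype_injective.comp D.M.subtype_injective

theorem coe_smul (m : D.M) (v : D.Δ) : ((m • v : D.Δ) : V) = D.incl m • (v : V) := rfl

theorem mem_socle_iff (x : G) : x ∈ socle G ↔ ∃ m, D.incl m = x := by
  rw [D.typeBi.socle_eq]
  constructor
  · rintro ⟨y, hy, rfl⟩
    exact ⟨⟨y, hy⟩, rfl⟩
  · rintro ⟨m, rfl⟩
    exact ⟨m, m.2, rfl⟩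

theorem incl_mem_socle (m : D.M) : D.incl m ∈ socle G := (D.mem_socle_iff _).2 ⟨m, rfl⟩

theorem normal_socle (D : Decomposition V G T l) : (socle G).Normal := by
  rw [D.typeBi.socle_eq]; exact D.typeBi.minimalN.1

theorem conj_mem_socle (x : G) (m : D.M) : x * D.incl m * x⁻¹ ∈ socle G :=
  D.normal_socle.conj_mem _ (D.incl_mem_socle m) x

variable {T' : Type*} [Group T'] {l' : ℕ} (D' : Decomposition V G T' l')

theorem exists_conj (x : G) (m : D.M) : ∃ m' : D'.M, D'.incl m' = x * D.incl m * x⁻¹ :=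
  (D'.mem_socle_iff _).1 (D.conj_mem_socle x m)

/-- Conjugation by `x`, as an isomorphism between the socles of the two decompositions. -/
noncomputable def conjEquiv (x : G) : D.M ≃* D'.M where
  toFun m := (D.exists_conj D' x m).choose
  invFun m := (D'.exists_conj D x⁻¹ m).choose
  left_inv m := D.incl_injective (by
    rw [(D'.exists_conj D x⁻¹ _).choose_spec, (D.exists_conj D' x m).choose_spec]; group)
  right_inv m := D'.incl_injective (by
    rw [(D.exists_conj D' x _).choose_spec, (D'.exists_conj D x⁻¹ m).choose_spec]; group)
  map_mul' a b := D'.incl_injective (by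
    rw [(D.exists_conj D' x _).choose_spec, map_mul D'.incl, (D.exists_conj D' x a).choose_spec,
      (D.exists_conj D' x b).choose_spec, map_mul]; group)

theorem incl_conjEquiv (x : G) (m : D.M) :
    D'.incl (D.conjEquiv D' x m) = x * D.incl m * x⁻¹ :=
  (D.exists_conj D' x m).choose_spec

theorem conjEquiv_mul (x y : G) (m : D.M) :
    D.conjEquiv D' (x * y) m = D.conjEquiv D' x (D.conjEquiv D y m) := by
  apply D'.incl_injective
  simp only [incl_conjEquiv]
  group

theorem conjEquiv_incl (x m : D.M) : D.conjEquiv D (D.incl x) m = x * m * x⁻¹ := by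
  apply D.incl_injective
  simp [incl_conjEquiv]

/-- `R` as a subgroup of `G`. -/
def groupR : Subgroup G := D.R.map (plus G D.Δ).subtype

/-- `S` as a subgroup of `G`. -/
def groupS : Subgroup G := D.S.map (plus G D.Δ).subtype

/-- The projection of `M` onto `R`. -/
def coordR : D.M →* (Fin l → T) := (MonoidHom.fst _ _).comp D.e.toMonoidHom

/-- The projection of `M` onto `S`. -/
def coordS : D.M →* (Fin l → T) := (MonoidHom.snd _ _).comp D.e.toMonoidHom

/-- The embedding of `T_{R,1} × ⋯ × T_{R,l}`. -/
def sectR : (Fin l → T) →* D.M := D.e.symm.toMonoidHom.comp (MonoidHom.inl _ _)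

/-- The embedding of `T_{S,1} × ⋯ × T_{S,l}`. -/
def sectS : (Fin l → T) →* D.M := D.e.symm.toMonoidHom.comp (MonoidHom.inr _ _)

theorem coordR_sectR (f : Fin l → T) : D.coordR (D.sectR f) = f := by simp [coordR, sectR]

theorem coordS_sectS (f : Fin l → T) : D.coordS (D.sectS f) = f := by simp [coordS, sectS]

theorem incl_mem_groupR_iff (m : D.M) : D.incl m ∈ D.groupR ↔ D.coordS m = 1 := by
  rw [groupR, incl, MonoidHom.comp_apply,
    Subgroup.mem_map_iff_mem (plus G D.Δ).subtype_injective]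
  exact D.mem_R m

theorem incl_mem_groupS_iff (m : D.M) : D.incl m ∈ D.groupS ↔ D.coordR m = 1 := by
  rw [groupS, incl, MonoidHom.comp_apply,
    Subgroup.mem_map_iff_mem (plus G D.Δ).subtype_injective]
  exact D.mem_S m

theorem mem_range_sectR_iff (m : D.M) : m ∈ D.sectR.range ↔ D.incl m ∈ D.groupR := by
  rw [incl_mem_groupR_iff]
  constructor
  · rintro ⟨f, rfl⟩; simp [coordS, sectR]
  · intro h
    refine ⟨D.coordR m, D.e.injective ?_⟩
    refine Prod.ext (by simp [coordR, sectR]) ?_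
    simpa [sectR, coordS] using h.symm

theorem mem_range_sectS_iff (m : D.M) : m ∈ D.sectS.range ↔ D.incl m ∈ D.groupS := by
  rw [incl_mem_groupS_iff]
  constructor
  · rintro ⟨f, rfl⟩; simp [coordR, sectS]
  · intro h
    refine ⟨D.coordS m, D.e.injective ?_⟩
    refine Prod.ext ?_ (by simp [coordS, sectS])
    simpa [sectS, coordR] using h.symm

theorem groupR_le_socle : D.groupR ≤ socle G := by
  rintro _ ⟨x, hx, rfl⟩
  exact (D.mem_socle_iff _).2 ⟨⟨x, Subgroup.mem_sup_left hx⟩, rfl⟩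

theorem groupS_eq {g : G} (hg : g ∉ plus G D.Δ) :
    D.groupS = D.groupR.map (MulAut.conj g).toMonoidHom := D.typeBi.conj g hg

theorem groupR_eq {g : G} (hg : g ∉ plus G D.Δ) :
    D.groupR = D.groupS.map (MulAut.conj g).toMonoidHom := by
  rw [D.groupS_eq (g := g⁻¹) (fun h => hg (by simpa using inv_mem h)), map_conj_map_conj,
    mul_inv_cancel, map_conj_one]

theorem minimal_groupR : IsMinimalNormalizedBy (plus G D.Δ) D.groupR :=
  D.typeBi.minimal.isMinimalNormalizedBy

theorem minimal_groupS (hΔ : ∀ x : G, x • D.Δ = D.Δ ∨ x • D.Δ = D.Δᶜ)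
    {g : G} (hg : g ∉ plus G D.Δ) : IsMinimalNormalizedBy (plus G D.Δ) D.groupS := by
  rw [D.groupS_eq hg]
  have := D.minimal_groupR.map_conj g
  rwa [map_conj_plus hΔ] at this

/-- A minimal subgroup of the socle normalised by `G⁺` is `R` or `S`. -/
theorem eq_groupR_or_groupS (hΔ : ∀ x : G, x • D.Δ = D.Δ ∨ x • D.Δ = D.Δᶜ)
    {g : G} (hg : g ∉ plus G D.Δ) {L : Subgroup G} (hL : IsMinimalNormalizedBy (plus G D.Δ) L)
    (hle : L ≤ socle G) : L = D.groupR ∨ L = D.groupS := by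
  by_contra! hne
  have hR := (hL.eq_or_commute D.minimal_groupR).resolve_left hne.1
  have hS := (hL.eq_or_commute (D.minimal_groupS hΔ hg)).resolve_left hne.2
  refine hL.ne_bot ((Subgroup.eq_bot_iff_forall L).2 fun x hx => ?_)
  obtain ⟨m, rfl⟩ := (D.mem_socle_iff x).1 (hle hx)
  have := D.simple
  have hc := center_eq_bot_of_isSimpleGroup D.nonabelian
  -- An element commuting with both R and S has every coordinate in the trivial centre of `T`.
  have hcomm : ∀ n : D.M, D.incl n ∈ D.groupR ∨ D.incl n ∈ D.groupS → m * n = n * m := by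
    rintro n (hn | hn) <;> apply D.incl_injective <;> rw [map_mul, map_mul]
    · exact hR _ hx _ hn
    · exact hS _ hx _ hn
  have h1 : D.coordR m = 1 := by
    ext i
    have : D.coordR m i ∈ Subgroup.center T := Subgroup.mem_center_iff.2 fun t => by
      have := congrArg D.coordR
        (hcomm (D.sectR fun _ => t) (Or.inl ((D.mem_range_sectR_iff _).1 ⟨_, rfl⟩)))
      rw [map_mul, map_mul, coordR_sectR] at this
      exact (congrFun this i).symm
    rwa [hc, Subgroup.mem_bot] at this
  have h2 : D.coordS m = 1 := by
    ext i
    have : D.coordS m i ∈ Subgroup.center T := Subgroup.mem_center_iff.2 fun t => by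
      have := congrArg D.coordS
        (hcomm (D.sectS fun _ => t) (Or.inr ((D.mem_range_sectS_iff _).1 ⟨_, rfl⟩)))
      rw [map_mul, map_mul, coordS_sectS] at this
      exact (congrFun this i).symm
    rwa [hc, Subgroup.mem_bot] at this
  have hm : m = 1 := D.e.injective ((Prod.ext h1 h2 : D.e m = 1).trans (map_one D.e).symm)
  rw [hm, map_one]

/-- `G⁺` permutes the simple factors of a minimal normal subgroup transitively. -/
theorem exists_conj_coordinate {L L' : Subgroup G} (hL : IsMinimalNormalizedBy (plus G D.Δ) L)
    (hL' : IsMinimalNormalizedBy (plus G D.Δ) L') (p : D.M →* (Fin l → T))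
    (s : (Fin l → T) →* D.M) (hps : ∀ f, p (s f) = f) (hs : ∀ m, m ∈ s.range ↔ D.incl m ∈ L)
    (hk : ∀ m, D.incl m ∈ L' ↔ p m = 1) (i j : Fin l) :
    ∃ h ∈ plus G D.Δ, ∃ τ : T ≃* T, ∀ m, p (D.conjEquiv D h m) j = τ (p m i) := by
  have := D.simple
  -- The automorphisms of M induced by conjugation in G⁺.
  let A : Subgroup (MulAut D.M) :=
    { carrier := {c | ∃ h ∈ plus G D.Δ, ∀ m, D.incl (c m) = h * D.incl m * h⁻¹}
      one_mem' := ⟨1, one_mem _, fun m => by simp⟩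
      mul_mem' := by
        rintro c c' ⟨h, hh, hc⟩ ⟨h', hh', hc'⟩
        exact ⟨h * h', mul_mem hh hh', fun m => by
          rw [MulAut.mul_apply, hc, hc']; group⟩
      inv_mem' := by
        rintro c ⟨h, hh, hc⟩
        refine ⟨h⁻¹, inv_mem hh, fun m => ?_⟩
        have := hc (c⁻¹ m)
        rw [MulAut.apply_inv_self] at this
        rw [this]; group }
  obtain ⟨c, ⟨h, hh, hc⟩, τ, hτ⟩ := exists_aut_coordinate D.nonabelian p s hps A
    (by
      rintro c ⟨h, hh, hc⟩ m hm
      rw [MonoidHom.mem_ker, ← hk] at hm ⊢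
      rw [hc]; exact hL'.conj_mem h hh _ hm)
    (by
      rintro c ⟨h, hh, hc⟩ m hm
      rw [hs] at hm ⊢
      rw [hc]; exact hL.conj_mem h hh _ hm)
    (by
      intro K hK hinv
      have hKL : K.map D.incl ≤ L := by
        rintro _ ⟨m, hm, rfl⟩
        exact (hs m).1 (hK hm)
      rcases hL.eq_bot_or_eq (K.map D.incl) hKL (by
        rintro x hx _ ⟨m, hm, rfl⟩
        refine ⟨D.conjEquiv D x m, hinv (D.conjEquiv D x) ⟨x, hx, D.incl_conjEquiv D x⟩ m hm,
          D.incl_conjEquiv D x m⟩) with h1 | h1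
      · exact Or.inl ((Subgroup.map_eq_bot_iff_of_injective _ D.incl_injective).1 h1)
      · right
        refine le_antisymm hK fun m hm => ?_
        rw [hs, ← h1] at hm
        obtain ⟨n, hn, hnm⟩ := hm
        rwa [← D.incl_injective hnm]) i j
  refine ⟨h, hh, τ, fun m => ?_⟩
  rw [← hτ, D.incl_injective ((D.incl_conjEquiv D h m).trans (hc m).symm)]

end Decomposition

/-- For `d ≥ 2` the three factors are compared separately, through d ≤ d(d-1), 2(d-1) ≤ d(d-1) and
2(d-1)+1 ≤ 2d(d-1). -/
theorem pow_bound_le {d u l : ℕ} (hd : 2 ≤ d) (hu : 0 < u)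
    (h : l ≤ d ^ d * (d - 1) ^ (2 * (d - 1)) * u ^ (2 * (d - 1) + 1)) :
    l ≤ (d * (d - 1)) ^ (d * (d - 1)) * u ^ (2 * (d * (d - 1))) := by
  obtain ⟨e, rfl⟩ : ∃ e, d = e + 2 := ⟨d - 2, by omega⟩
  simp only [show e + 2 - 1 = e + 1 by omega] at h ⊢
  refine h.trans ?_
  rw [mul_pow]
  refine Nat.mul_le_mul (Nat.mul_le_mul ?_ ?_) ?_
  · exact Nat.pow_le_pow_right (by omega) (by nlinarith)
  · exact Nat.pow_le_pow_right (by omega) (by nlinarith)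
  · exact Nat.pow_le_pow_right hu (by nlinarith)

/-! ### Transport of Γ^Δ by group elements -/

section DistTwo

variable {V G : Type*} [Group G] [MulAction G V] {Γ : SimpleGraph V} {Δ Δ' : Set V}

theorem distTwoGraph_adj_iff_of_smul {x : G} (hadj : ∀ a b, Γ.Adj (x • a) (x • b) ↔ Γ.Adj a b)
    {u v : Δ} {u' v' : Δ'} (hu : (u' : V) = x • (u : V)) (hv : (v' : V) = x • (v : V)) :
    (distTwoGraph Γ Δ').Adj u' v' ↔ (distTwoGraph Γ Δ).Adj u v := by
  have hne : u' ≠ v' ↔ u ≠ v := by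
    rw [Ne, Ne, Subtype.ext_iff, Subtype.ext_iff, hu, hv, smul_left_cancel_iff]
  rw [distTwoGraph_adj_iff, distTwoGraph_adj_iff, hne, hu, hv, hadj]
  refine and_congr_right fun _ => or_congr_right ⟨?_, ?_⟩
  · rintro ⟨w, h₁, h₂⟩
    refine ⟨x⁻¹ • w, ?_, ?_⟩ <;> rw [← hadj, smul_inv_smul] <;> assumption
  · rintro ⟨w, h₁, h₂⟩
    exact ⟨x • w, (hadj _ _).2 h₁, (hadj _ _).2 h₂⟩

theorem exists_distTwoGraph_iso {x : G} (hadj : ∀ a b, Γ.Adj (x • a) (x • b) ↔ Γ.Adj a b)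
    (hx : x • Δ = Δ') :
    ∃ f : distTwoGraph Γ Δ ≃g distTwoGraph Γ Δ', ∀ u, (f u : V) = x • (u : V) := by
  subst hx
  refine ⟨⟨⟨fun u => ⟨x • (u : V), Set.smul_mem_smul_set u.2⟩,
    fun v => ⟨x⁻¹ • (v : V), Set.mem_smul_set_iff_inv_smul_mem.1 v.2⟩, fun u => ?_, fun v => ?_⟩,
    ?_⟩, fun u => rfl⟩
  · simp
  · simp
  · intro u v
    exact distTwoGraph_adj_iff_of_smul hadj rfl rfl

end DistTwo

/-! ### Bound, quotient pairs and uniqueness for a decomposition -/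

namespace Decomposition

variable {V G T : Type*} [Group G] [MulAction G V] [Group T] {l : ℕ} (D : Decomposition V G T l)

theorem stabilizer_coe (α : D.Δ) :
    MulAction.stabilizer D.M (α : V) = MulAction.stabilizer D.M α := by
  ext m
  rw [MulAction.mem_stabilizer_iff, MulAction.mem_stabilizer_iff, Subtype.ext_iff]
  rfl

theorem orbit_eq (α : D.Δ) : MulAction.orbit D.M (α : V) = D.Δ := by
  have := D.typeBi.transitive
  ext v
  constructor
  · rintro ⟨m, rfl⟩
    exact (m • α : D.Δ).2
  · intro hv
    obtain ⟨m, hm⟩ := MulAction.exists_smul_eq D.M α ⟨v, hv⟩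
    exact ⟨m, congrArg Subtype.val hm⟩

/-- The socle depends on `G` alone, which makes any two choices of the half translates of each
other. -/
theorem orbit_socle_eq (α : D.Δ) : MulAction.orbit (socle G) (α : V) = D.Δ := by
  refine Eq.trans ?_ (D.orbit_eq α)
  ext v
  constructor
  · rintro ⟨⟨y, hy⟩, rfl⟩
    obtain ⟨m, rfl⟩ := (D.mem_socle_iff y).1 hy
    exact ⟨m, rfl⟩
  · rintro ⟨m, rfl⟩
    exact ⟨⟨D.incl m, D.incl_mem_socle m⟩, rfl⟩

variable {d : ℕ} {Γ : SimpleGraph V}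

theorem smul_eq_or (hΓ : InFamilyA d Γ (MulAction.toPermHom G V))
    (hG : IsBiquasiprimitive G V)
    (x : G) : x • D.Δ = D.Δ ∨ x • D.Δ = D.Δᶜ := by
  have := hΓ.finite
  exact D.isHalf.smul_eq_or hG x

theorem exists_notMem_plus (hΓ : InFamilyA d Γ (MulAction.toPermHom G V)) :
    ∃ g : G, g ∉ plus G D.Δ := by
  obtain ⟨a, ha⟩ := D.isHalf.nonempty
  obtain ⟨b, hb⟩ := D.isHalf.exists_notMem
  obtain ⟨g, rfl⟩ := hΓ.transitive a b
  refine ⟨g, fun hg => hb ?_⟩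
  have hg' : g • D.Δ = D.Δ := hg
  rw [← hg']
  exact Set.smul_mem_smul_set ha

/-- M is normal in `G`, so conjugation by an element swapping the halves carries transitivity on `Δ`
to the complement. -/
theorem mem_orbit_of_notMem (hΓ : InFamilyA d Γ (MulAction.toPermHom G V))
    (hG : IsBiquasiprimitive G V)
    {u v : V} (hu : u ∉ D.Δ) (hv : v ∉ D.Δ) :
    v ∈ MulAction.orbit D.M u := by
  obtain ⟨g, hg⟩ := D.exists_notMem_plus hΓ
  have hgc := smul_eq_compl_of_notMem_plus (D.smul_eq_or hΓ hG) hg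
  have hmem : ∀ w, w ∉ D.Δ → g⁻¹ • w ∈ D.Δ := fun w hw => by
    rw [← Set.mem_smul_set_iff_inv_smul_mem, hgc]; exact hw
  have hmv := hmem v hv
  rw [← D.orbit_eq ⟨_, hmem u hu⟩] at hmv
  obtain ⟨m, hm⟩ := hmv
  have hm' : D.incl m • g⁻¹ • u = g⁻¹ • v := hm
  refine ⟨D.conjEquiv D g m, ?_⟩
  change D.incl (D.conjEquiv D g m) • u = v
  rw [incl_conjEquiv, mul_smul, mul_smul, hm', smul_inv_smul]


/-- The bound on `l`, for either of the two families of coordinates. -/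
theorem card_coordinates_bound (hΓ : InFamilyA d Γ (MulAction.toPermHom G V))
    (hG : IsBiquasiprimitive G V)
    {α : D.Δ} (p : D.M →* (Fin l → T)) (hp : Function.Surjective p)
    (htrans : ∀ i j, ∃ h ∈ plus G D.Δ, ∃ τ : T ≃* T, ∀ m, p (D.conjEquiv D h m) j = τ (p m i))
    (i : Fin l) (π : D.M →* T) (hπ : ∀ m, π m = p m i)
    (htop : ∀ α : D.Δ, (MulAction.stabilizer D.M α).map π ≠ ⊤) :
    l ≤ (d * (d - 1)) ^ (d * (d - 1)) *
      Nat.card ((MulAction.stabilizer D.M α).map π) ^ (2 * (d * (d - 1))) := by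
  have hV := hΓ.finite
  have hGfin : Finite G := Finite.of_injective _ hΓ.faithful
  have hT : Finite T := Finite.of_surjective π fun t => by
    obtain ⟨m, hm⟩ := hp fun _ => t
    exact ⟨m, by rw [hπ, hm]⟩
  have hΔ := D.smul_eq_or hΓ hG
  have hadj : ∀ (x : G) a b, Γ.Adj (x • a) (x • b) ↔ Γ.Adj a b := hΓ.adj_iff
  have hπ' : π = (Pi.evalMonoidHom (fun _ => T) i).comp p := MonoidHom.ext hπ
  obtain ⟨β, hβ, β', hβ', hββ'⟩ := exists_adj_cross hΓ D.isHalf.nonempty D.isHalf.exists_notMem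
  have hcard : Nat.card ((MulAction.stabilizer D.M α).map π) =
      Nat.card ((MulAction.stabilizer D.M β).map π) := by
    obtain ⟨m, hm⟩ : (α : V) ∈ MulAction.orbit D.M β :=
      (D.orbit_eq ⟨β, hβ⟩).symm.subset α.2
    have hm' : m • β = α := hm
    rw [← D.stabilizer_coe α, ← hm']
    exact natCard_map_stabilizer_smul π m β
  rw [hcard, hπ']
  have horb := D.orbit_eq ⟨β, hβ⟩
  simp only at horb
  obtain ⟨hd, hl⟩ := card_coordinates_le_of_connected (X := D.M) (d := d) (α := β) (α' := β')
    hΓ.connected (fun m => hadj (D.incl m)) hΓ.valency_le hββ' (by rwa [horb])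
    (fun v hv => D.mem_orbit_of_notMem hΓ hG hβ' (by rwa [horb] at hv))
    (by
      rw [horb]
      -- Outside `Δ` lie the crossing neighbours of `β` and the same-half neighbours of `β'`. By
      -- vertex-transitivity the latter are as many as the same-half neighbours of `β`, so the total
      -- is at most `d`.
      have h1 : (Γ.neighborSet β \ D.Δ) = {w | Γ.Adj β w ∧ ¬ (w ∈ D.Δ ↔ β ∈ D.Δ)} := by
        ext w; simp [hβ]
      have h2 : (Γ.neighborSet β' \ D.Δ) = {w | Γ.Adj β' w ∧ (w ∈ D.Δ ↔ β' ∈ D.Δ)} := by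
        ext w; simp [hβ']
      rw [h1, h2, ncard_adj_same_eq hΔ hΓ β' β, add_comm]
      exact ncard_adj_same_add_cross hΓ β)
    p hp
    (by
      intro i j
      obtain ⟨h, hh, τ, hτ⟩ := htrans i j
      have hhβ : h • β ∈ D.Δ := by
        have hh' : h • D.Δ = D.Δ := hh
        rw [← hh']; exact Set.smul_mem_smul_set hβ
      -- Multiplying `h` by an element of M makes it fix `β`; on coordinate `j` this only adds the
      -- inner automorphism given by `p n j`.
      have hβo : β ∈ MulAction.orbit D.M (h • β) := by
        rw [D.orbit_eq ⟨_, hhβ⟩]; exact hβ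
      obtain ⟨n, hn⟩ := hβo
      have hn' : D.incl n • h • β = β := hn
      refine ⟨⟨MulAction.toPerm (D.incl n * h), hadj _ _ _⟩, D.conjEquiv D (D.incl n * h),
        τ.trans (MulAut.conj (p n j)), ?_, ?_, ?_⟩
      · change (D.incl n * h) • β = β
        rw [mul_smul, hn']
      · intro m v
        change (D.incl n * h) • D.incl m • v =
          D.incl (D.conjEquiv D (D.incl n * h) m) • (D.incl n * h) • v
        rw [incl_conjEquiv, ← mul_smul, ← mul_smul, inv_mul_cancel_right]
      · intro m
        rw [conjEquiv_mul, conjEquiv_incl, map_mul, map_mul, map_inv, Pi.mul_apply, Pi.mul_apply,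
          Pi.inv_apply, hτ]
        rfl)
    i (by
      rw [← hπ', D.stabilizer_coe ⟨β, hβ⟩]
      exact htop ⟨β, hβ⟩)
  exact pow_bound_le hd Nat.card_pos hl

theorem adj_distTwoGraph_smul (hΓ : InFamilyA d Γ (MulAction.toPermHom G V))
    (m : D.M) (u v : D.Δ) :
    (distTwoGraph Γ D.Δ).Adj (m • u) (m • v) ↔ (distTwoGraph Γ D.Δ).Adj u v :=
  distTwoGraph_adj_iff_of_smul (hΓ.adj_iff (D.incl m)) rfl rfl

theorem isVertexTransitivePair (hΓ : InFamilyA d Γ (MulAction.toPermHom G V))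
    (hG : IsBiquasiprimitive G V)
    (π : D.M →* T) (hπ : Function.Surjective π) (α : D.Δ)
    (hα : (MulAction.stabilizer D.M α).map π ≠ ⊤) :
    IsVertexTransitivePair (d * (d - 1)) (normalQuotient π.ker (distTwoGraph Γ D.Δ))
      (quotientAction π hπ) := by
  have := hΓ.finite
  have := D.simple
  have := D.typeBi.transitive
  exact isVertexTransitivePair_quotient _ _ (D.adj_distTwoGraph_smul hΓ)
    (ncard_neighborSet_distTwoGraph_le (D.smul_eq_or hΓ hG) hΓ D.isHalf.nonempty
      D.isHalf.exists_notMem) π hπ α hα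

theorem exists_conj_coordR (hΓ : InFamilyA d Γ (MulAction.toPermHom G V))
    (hG : IsBiquasiprimitive G V)
    (i j : Fin l) :
    ∃ h ∈ plus G D.Δ, ∃ τ : T ≃* T, ∀ m, D.coordR (D.conjEquiv D h m) j = τ (D.coordR m i) := by
  obtain ⟨g, hg⟩ := D.exists_notMem_plus hΓ
  exact D.exists_conj_coordinate D.minimal_groupR (D.minimal_groupS (D.smul_eq_or hΓ hG) hg)
    D.coordR D.sectR D.coordR_sectR D.mem_range_sectR_iff D.incl_mem_groupS_iff i j

theorem exists_conj_coordS (hΓ : InFamilyA d Γ (MulAction.toPermHom G V))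
    (hG : IsBiquasiprimitive G V)
    (i j : Fin l) :
    ∃ h ∈ plus G D.Δ, ∃ τ : T ≃* T, ∀ m, D.coordS (D.conjEquiv D h m) j = τ (D.coordS m i) := by
  obtain ⟨g, hg⟩ := D.exists_notMem_plus hΓ
  exact D.exists_conj_coordinate (D.minimal_groupS (D.smul_eq_or hΓ hG) hg) D.minimal_groupR
    D.coordS D.sectS D.coordS_sectS D.mem_range_sectS_iff D.incl_mem_groupR_iff i j

variable {T' : Type*} [Group T'] {l' : ℕ}

theorem exists_smul_half_eq (hΓ : InFamilyA d Γ (MulAction.toPermHom G V))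
    (D' : Decomposition V G T' l') :
    ∃ x : G, x • D.Δ = D'.Δ := by
  obtain ⟨a, ha⟩ := D.isHalf.nonempty
  obtain ⟨b, hb⟩ := D'.isHalf.nonempty
  obtain ⟨x, rfl⟩ := hΓ.transitive a b
  have := D.normal_socle
  refine ⟨x, ?_⟩
  rw [← D.orbit_socle_eq ⟨a, ha⟩, ← D'.orbit_socle_eq ⟨_, hb⟩]
  exact (orbit_smul_eq_smul_orbit (socle G) x a).symm

/-- If conjugation by `x` moves the coordinates `p` of one decomposition to the coordinates `p'`
of another, then the quotient pairs are isomorphic. -/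
theorem pairIso_of_coordinates (hΓ : InFamilyA d Γ (MulAction.toPermHom G V))
    (D' : Decomposition V G T' l')
    {x : G} (hx : x • D.Δ = D'.Δ) (p : D.M →* (Fin l → T))
    (s : (Fin l → T) →* D.M) (hps : ∀ f, p (s f) = f)
    (htrans : ∀ i j, ∃ h ∈ plus G D.Δ, ∃ τ : T ≃* T, ∀ m, p (D.conjEquiv D h m) j = τ (p m i))
    (p' : D'.M →* (Fin l' → T')) (hker : ∀ m, p m = 1 → p' (D.conjEquiv D' x m) = 1)
    (j : Fin l) (π : D.M →* T) (hπ : Function.Surjective π) (hπp : ∀ m, π m = p m j)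
    (j' : Fin l') (π' : D'.M →* T') (hπ' : Function.Surjective π')
    (hπp' : ∀ m, π' m = p' m j') :
    PairIso (normalQuotient π.ker (distTwoGraph Γ D.Δ)) (quotientAction π hπ)
      (normalQuotient π'.ker (distTwoGraph Γ D'.Δ)) (quotientAction π' hπ') := by
  have := D.simple
  have := D'.simple
  obtain ⟨i, τ, hτ⟩ := exists_eval_of_ker_le D'.nonabelian p s hps
    (π'.comp (D.conjEquiv D' x).toMonoidHom) (hπ'.comp (D.conjEquiv D' x).surjective)
    (fun m hm => by
      change π' (D.conjEquiv D' x m) = 1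
      rw [hπp', hker m hm, Pi.one_apply])
  -- Conjugation by `x` matches coordinate `i`, not necessarily `j`, with `j'`. Composing with `h`,
  -- which preserves `Δ`, corrects this.
  obtain ⟨h, hh, τ', hτ'⟩ := htrans j i
  have hxh : (x * h) • D.Δ = D'.Δ := by
    have hh' : h • D.Δ = D.Δ := hh
    rw [mul_smul, hh', hx]
  obtain ⟨f, hf⟩ := exists_distTwoGraph_iso (Γ := Γ) (hΓ.adj_iff (x * h)) hxh
  refine pairIso_quotient π hπ π' hπ' (D.conjEquiv D' (x * h)) f ?_ (τ'.trans τ) ?_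
  · intro m w
    apply Subtype.ext
    rw [hf, coe_smul, coe_smul, hf, incl_conjEquiv, ← mul_smul, ← mul_smul, inv_mul_cancel_right]
  · intro m
    have h1 : π' (D.conjEquiv D' x (D.conjEquiv D h m)) = τ (p (D.conjEquiv D h m) i) := hτ _
    rw [conjEquiv_mul, h1, hτ', hπp]
    rfl

theorem incl_conjEquiv_mem (D' : Decomposition V G T' l')
    {L L' : Subgroup G} {x : G}
    (hL : L'.map (MulAut.conj x⁻¹).toMonoidHom = L) {m : D.M} (hm : D.incl m ∈ L) :
    D'.incl (D.conjEquiv D' x m) ∈ L' := by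
  rw [← hL] at hm
  obtain ⟨y, hy, hym⟩ := hm
  rw [incl_conjEquiv, ← hym]
  have : x * (MulAut.conj x⁻¹).toMonoidHom y * x⁻¹ = y := by simp [mul_assoc]
  rwa [this]

/-- Up to the element moving one half to the other, the two decompositions have the same minimal
normal subgroups. -/
theorem groups_eq_or (hΓ : InFamilyA d Γ (MulAction.toPermHom G V))
    (hG : IsBiquasiprimitive G V)
    (D' : Decomposition V G T' l')
    {x : G} (hx : x • D.Δ = D'.Δ) :
    (D'.groupR.map (MulAut.conj x⁻¹).toMonoidHom = D.groupR ∧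
      D'.groupS.map (MulAut.conj x⁻¹).toMonoidHom = D.groupS) ∨
    (D'.groupR.map (MulAut.conj x⁻¹).toMonoidHom = D.groupS ∧
      D'.groupS.map (MulAut.conj x⁻¹).toMonoidHom = D.groupR) := by
  obtain ⟨g, hg⟩ := D.exists_notMem_plus hΓ
  have hx' : x⁻¹ • D'.Δ = D.Δ := by rw [← hx, inv_smul_smul]
  have hmin : IsMinimalNormalizedBy (plus G D.Δ)
      (D'.groupR.map (MulAut.conj x⁻¹).toMonoidHom) := by
    have := D'.minimal_groupR.map_conj x⁻¹
    rwa [← MulAction.stabilizer_smul_eq_stabilizer_map_conj, hx'] at this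
  have hle : D'.groupR.map (MulAut.conj x⁻¹).toMonoidHom ≤ socle G := by
    rintro _ ⟨y, hy, rfl⟩
    exact D.normal_socle.conj_mem y (D'.groupR_le_socle hy) x⁻¹
  have hg' : x * g * x⁻¹ ∉ plus G D'.Δ := by
    intro h
    have h1 : (x * g * x⁻¹) • D'.Δ = D'.Δ := h
    rw [mul_smul, mul_smul, hx', ← hx, smul_left_cancel_iff] at h1
    exact hg h1
  -- As S is the conjugate of R by any element swapping the halves, the image of R decides that of
  -- S.
  have hS : D'.groupS.map (MulAut.conj x⁻¹).toMonoidHom =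
      (D'.groupR.map (MulAut.conj x⁻¹).toMonoidHom).map (MulAut.conj g).toMonoidHom := by
    rw [D'.groupS_eq hg', map_conj_map_conj, map_conj_map_conj]
    congr 3
    group
  rcases D.eq_groupR_or_groupS (D.smul_eq_or hΓ hG) hg hmin hle with h | h
  · exact Or.inl ⟨h, by rw [hS, h, ← D.groupS_eq hg]⟩
  · exact Or.inr ⟨h, by rw [hS, h, ← D.groupR_eq hg]⟩

end Decomposition

end BiQP

/-! ### The main theorem -/

open BiQP in
theorem mainTheorem5 {V G T : Type*} [Group G] [MulAction G V] [Group T]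
    (d l : ℕ) (Γ : SimpleGraph V)
    (hΓ : InFamilyA d Γ (MulAction.toPermHom G V))
    (hG : IsBiquasiprimitive G V)
    (D : Decomposition V G T l) (hD : D.NonSurjective) :
    -- the bound on `l`
    (∀ (α : D.Δ) (i j : Fin l) (lamR : T ⧸ D.UR i α) (lamS : T ⧸ D.US j α),
      l ≤ (d * (d - 1)) ^ (d * (d - 1)) *
        (min (Nat.card (MulAction.stabilizer T lamR))
          (Nat.card (MulAction.stabilizer T lamS))) ^ (2 * (d * (d - 1)))) ∧
    -- the pairs `(Λ_R, T)` and `(Λ_S, T)`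
    (∀ j : Fin l,
      IsVertexTransitivePair (d * (d - 1)) (D.graphR Γ j) (D.actionR j) ∧
      IsVertexTransitivePair (d * (d - 1)) (D.graphS Γ j) (D.actionS j)) ∧
    ((distTwoGraph Γ D.Δ).Connected → ∀ j : Fin l,
      InFamilyA (d * (d - 1)) (D.graphR Γ j) (D.actionR j) ∧
      InFamilyA (d * (d - 1)) (D.graphS Γ j) (D.actionS j)) ∧
    ((∀ u v, Γ.Adj u v → (u ∈ D.Δ ↔ v ∉ D.Δ)) → (distTwoGraph Γ D.Δ).Connected) ∧
    -- the vertex stabilisers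
    (∀ (α : D.Δ) (j : Fin l),
      (∀ lamR : T ⧸ D.UR j α,
        StabilizersConj (D.actionR j) (MulAction.stabilizer T lamR)) ∧
      (∀ lamS : T ⧸ D.US j α,
        StabilizersConj (D.actionS j) (MulAction.stabilizer T lamS))) ∧
    -- uniqueness: the two pairs do not depend on any of the choices made
    (∀ {T' : Type*} [Group T'] (l' : ℕ) (D' : Decomposition V G T' l'),
      (∀ (j : Fin l) (j' : Fin l'),
        PairIso (D.graphR Γ j) (D.actionR j) (D'.graphR Γ j') (D'.actionR j') ∧
        PairIso (D.graphS Γ j) (D.actionS j) (D'.graphS Γ j') (D'.actionS j')) ∨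
      (∀ (j : Fin l) (j' : Fin l'),
        PairIso (D.graphR Γ j) (D.actionR j) (D'.graphS Γ j') (D'.actionS j') ∧
        PairIso (D.graphS Γ j) (D.actionS j) (D'.graphR Γ j') (D'.actionR j'))) := by
  have hRsurj : Function.Surjective D.coordR := fun f => ⟨_, D.coordR_sectR f⟩
  have hSsurj : Function.Surjective D.coordS := fun f => ⟨_, D.coordS_sectS f⟩
  obtain ⟨a₀, ha₀⟩ := D.isHalf.nonempty
  have hpair : ∀ j : Fin l,
      IsVertexTransitivePair (d * (d - 1)) (D.graphR Γ j) (D.actionR j) ∧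
      IsVertexTransitivePair (d * (d - 1)) (D.graphS Γ j) (D.actionS j) := fun j =>
    ⟨D.isVertexTransitivePair hΓ hG (D.projR j) (D.projR_surjective j) ⟨a₀, ha₀⟩ (hD j _).1,
      D.isVertexTransitivePair hΓ hG (D.projS j) (D.projS_surjective j) ⟨a₀, ha₀⟩ (hD j _).2⟩
  refine ⟨?_, hpair, ?_, distTwoGraph_connected hΓ.connected D.isHalf.nonempty, ?_, ?_⟩
  · intro α i j lamR lamS
    rw [natCard_stabilizer_coset, natCard_stabilizer_coset]
    have hR := D.card_coordinates_bound hΓ hG (α := α) D.coordR hRsurj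
      (D.exists_conj_coordR hΓ hG) i (D.projR i) (fun _ => rfl) (fun β => (hD i β).1)
    have hS := D.card_coordinates_bound hΓ hG (α := α) D.coordS hSsurj
      (D.exists_conj_coordS hΓ hG) j (D.projS j) (fun _ => rfl) (fun β => (hD j β).2)
    rcases min_choice (Nat.card (D.UR i α)) (Nat.card (D.US j α)) with h | h <;> rw [h]
    · exact hR
    · exact hS
  · intro hconn j
    exact ⟨⟨(hpair j).1, normalQuotient_connected _ hconn⟩,
      ⟨(hpair j).2, normalQuotient_connected _ hconn⟩⟩
  · intro α j
    have := D.typeBi.transitive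
    exact ⟨stabilizersConj_quotientAction (D.projR j) (D.projR_surjective j) α,
      stabilizersConj_quotientAction (D.projS j) (D.projS_surjective j) α⟩
  · intro T' _ l' D'
    obtain ⟨x, hx⟩ := D.exists_smul_half_eq hΓ D'
    have hR := D.exists_conj_coordR hΓ hG
    have hS := D.exists_conj_coordS hΓ hG
    -- Coordinates of R vanish exactly on S and conversely, so matching the R-coordinates of `D`
    -- uses the equation whose right side is `D.groupS`, and matching its S-coordinates the other
    -- one.
    rcases D.groups_eq_or hΓ hG D' hx with ⟨h₁, h₂⟩ | ⟨h₁, h₂⟩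
    · refine Or.inl fun j j' => ⟨?_, ?_⟩
      · exact D.pairIso_of_coordinates hΓ D' hx D.coordR D.sectR D.coordR_sectR hR D'.coordR
          (fun m hm => (D'.incl_mem_groupS_iff _).1
            (D.incl_conjEquiv_mem D' h₂ ((D.incl_mem_groupS_iff m).2 hm)))
          j _ (D.projR_surjective j) (fun _ => rfl) j' _ (D'.projR_surjective j') (fun _ => rfl)
      · exact D.pairIso_of_coordinates hΓ D' hx D.coordS D.sectS D.coordS_sectS hS D'.coordS
          (fun m hm => (D'.incl_mem_groupR_iff _).1
            (D.incl_conjEquiv_mem D' h₁ ((D.incl_mem_groupR_iff m).2 hm)))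
          j _ (D.projS_surjective j) (fun _ => rfl) j' _ (D'.projS_surjective j') (fun _ => rfl)
    · refine Or.inr fun j j' => ⟨?_, ?_⟩
      · exact D.pairIso_of_coordinates hΓ D' hx D.coordR D.sectR D.coordR_sectR hR D'.coordS
          (fun m hm => (D'.incl_mem_groupR_iff _).1
            (D.incl_conjEquiv_mem D' h₁ ((D.incl_mem_groupS_iff m).2 hm)))
          j _ (D.projR_surjective j) (fun _ => rfl) j' _ (D'.projS_surjective j') (fun _ => rfl)
      · exact D.pairIso_of_coordinates hΓ D' hx D.coordS D.sectS D.coordS_sectS hS D'.coordR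
          (fun m hm => (D'.incl_mem_groupS_iff _).1
            (D.incl_conjEquiv_mem D' h₂ ((D.incl_mem_groupR_iff m).2 hm)))
          j _ (D.projS_surjective j) (fun _ => rfl) j' _ (D'.projR_surjective j') (fun _ => rfl)
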